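/- **Theorem.** Let $(R,\mathfrak m)$ be a (Noetherian) Cohen–Macaulay local ring with $\dim R=1$ and total ring of fractions $\mathrm Q(R)$; let $\overline R$ be the integral closure of $R$ in $\mathrm Q(R)$. For a one-dimensional Cohen–Macaulay local ring $(S,\mathfrak n)$ let $\mathrm v(S)=\mu_S(\mathfrak n)$ be the embedding dimension and $\mathrm e(S)=\lim_{n\to\infty}\ell_S(S/\mathfrak n^n)/n$ the multiplicity, where $\mu_S$ is the minimal number of generators and $\ell_S$ the length. An ideal $Q\subseteq I$ is a *reduction* of $I$ if $I^{n+1}=QI^n$ for some $n\ge 0$. An $\mathfrak m$-primary ideal $I$ of $R$ is an *Ulrich ideal* if it contains a parameter ideal $Q=(a)$ as a reduction such that $I\ne Q$, $I^2=QI$, and $I/I^2$ is a free $R/I$-module. For an $R$-submodule $M$ of $\mathrm Q(R)$ put $M:M=\{x\in \mathrm Q(R)\mid xM\subseteq M\}$. Assume that $v:=\mathrm v(R)=\mathrm e(R)>1$ and let $\alpha\in\mathfrak m$ satisfy $\mathfrak m^2=\alpha\mathfrak m$. Let $I$ be an Ulrich ideal of $R$. Then there is a composition series of ideals $$(E)\qquad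 I=I_\ell\subsetneq I_{\ell-1}\subsetneq\cdots\subsetneq I_1=\mathfrak m$$ (that is, no ideal lies strictly between consecutive terms) in which every $I_i$ is an Ulrich ideal. For every such series, $\ell=\ell_R(R/I)$. Set $B_0=R$ and $B_i=I_i:I_i$ for $1\le i\le \ell$, and let $\mathfrak n_i$ be the Jacobson radical of $B_i$ for $0\le i\le\ell$. Then $$R=B_0\subsetneq B_1\subsetneq\cdots\subsetneq B_{\ell-1}\subsetneq B_\ell\subseteq\overline R$$ is a tower of birational finite extensions of $R$, and the following hold. 1. $(\alpha^i)$ is a reduction of $I_i$ for every $1\le i\le \ell$. 2. $B_i=\mathfrak n_{i-1}:\mathfrak n_{i-1}$ for every $1\le i\le\ell$. 3. For $0\le i\le \ell-1$, $(B_i,\mathfrak n_i)$ is a one-dimensional Cohen–Macaulay local ring with $\mathrm v(B_i)=\mathrm e(B_i)=\mathrm e(R)>1$ and $\mathfrak n_i^2=\alpha\mathfrak n_i$. 4. There are $x_2,\dots,x_v\in I$ with $I=(\alpha^\ell,x_2,\dots,x_v)$, and for every such choice $I_i=(\alpha^i,x_2,\dots,x_v)$ for all $1\le i\le \ell$; in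 particular $\mathfrak m=(\alpha,x_2,\dots,x_v)$. The series $(E)$ is the unique composition series of ideals of $R$ connecting $I$ and $\mathfrak m$. 5. If $J$ is an ideal of $R$ with $I\subseteq J\subseteq\mathfrak m$, then $J=I_i$ for some $1\le i\le\ell$. -/

import Mathlib

open IsLocalRing Filter Topology
open scoped nonZeroDivisors ENNReal

noncomputable section

namespace UlrichChain

section General

variable {R : Type*} [CommRing R]

/-- `Q` is a reduction of `I`: `Q ⊆ I` and `I ^ (n + 1) = Q I ^ n` for some `n ≥ 0`. -/
def IsReduction (Q I : Ideal R) : Prop :=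
  Q ≤ I ∧ ∃ n : ℕ, I ^ (n + 1) = Q * I ^ n

end General

section Local

variable (R : Type*) [CommRing R] [IsLocalRing R]

/-- A Noetherian local ring is Cohen-Macaulay if its maximal ideal contains a regular sequence
whose length is the Krull dimension. -/
def IsCohenMacaulayLocal : Prop :=
  IsNoetherianRing R ∧ ∃ rs : List R, (∀ r ∈ rs, r ∈ maximalIdeal R) ∧
    RingTheory.Sequence.IsRegular R rs ∧ ringKrullDim R = (rs.length : WithBot ℕ∞)

/-- The embedding dimension `v(R)`: the minimal number of generators of the maximal ideal. -/
def embDim : ℕ := (maximalIdeal R).spanFinrank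

/-- For a local ring of dimension one: the multiplicity `e(R) = lim ℓ_R(R / 𝔪 ^ n) / n` exists
and equals `e`. -/
def HasMultiplicity (e : ℕ) : Prop :=
  Tendsto (fun n : ℕ => ((Module.length R (R ⧸ maximalIdeal R ^ n) : ℕ∞) : ℝ≥0∞) / (n : ℝ≥0∞))
    atTop (𝓝 (e : ℝ≥0∞))

variable {R}

/-- A parameter ideal: an `𝔪`-primary ideal generated by `dim R` elements. -/
def IsParameterIdeal (Q : Ideal R) : Prop :=
  Q.radical = maximalIdeal R ∧
    ∃ (d : ℕ) (a : Fin d → R), ringKrullDim R = (d : WithBot ℕ∞) ∧ Q = Ideal.span (Set.range a)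

/-- Ulrich ideals: `𝔪`-primary ideals `I` containing a parameter ideal `Q` as a reduction such that
`I ≠ Q`, `I ^ 2 = Q I`, and `I / I ^ 2` is a free `R / I`-module. -/
structure IsUlrich (I : Ideal R) : Prop where
  radical_eq : I.radical = maximalIdeal R
  exists_reduction : ∃ Q : Ideal R,
    IsParameterIdeal Q ∧ IsReduction Q I ∧ I ≠ Q ∧ I ^ 2 = Q * I
  free : Module.Free (R ⧸ I) I.Cotangent

/-- `I = c ℓ ⊊ c (ℓ - 1) ⊊ ⋯ ⊊ c 1 = 𝔪` is a composition series of ideals connecting `I` and `𝔪`;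
only the values `c 1, …, c ℓ` matter. -/
structure IsCompSeries (I : Ideal R) (ℓ : ℕ) (c : ℕ → Ideal R) : Prop where
  one_le : 1 ≤ ℓ
  first : c 1 = maximalIdeal R
  last : c ℓ = I
  covBy : ∀ i, 1 ≤ i → i < ℓ → c (i + 1) ⋖ c i

end Local

section Overrings

variable {R : Type*} [CommRing R] {K : Type*} [CommRing K] [Algebra R K]

/-- `M : M = {x ∈ K | x M ⊆ M}`, as a subalgebra of `K`. -/
def selfColon (M : Submodule R K) : Subalgebra R K where
  carrier := {x | ∀ y ∈ M, x * y ∈ M}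
  mul_mem' {a b} ha hb y hy := by
    rw [mul_assoc]
    exact ha _ (hb _ hy)
  add_mem' {a b} ha hb y hy := by
    rw [add_mul]
    exact M.add_mem (ha _ hy) (hb _ hy)
  algebraMap_mem' r y hy := by
    rw [← Algebra.smul_def]
    exact M.smul_mem r hy

/-- The Jacobson radical of a subring `B` of `K`, as an ideal of `B`. -/
def jacobsonRadical (B : Subalgebra R K) : Ideal B := Ideal.jacobson ⊥

/-- The Jacobson radical of a subring `B` of `K`, as an `R`-submodule of `K`. -/
def jacobsonSubmodule (B : Subalgebra R K) : Submodule R K :=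
  ((jacobsonRadical B).restrictScalars R).map B.val.toLinearMap

variable (K) in
/-- `B 0 = R` and `B i = c i : c i` (computed in `K`) for `i ≥ 1`. -/
def overring (c : ℕ → Ideal R) : ℕ → Subalgebra R K
  | 0 => ⊥
  | i + 1 => selfColon (IsLocalization.coeSubmodule K (c (i + 1)))

end Overrings

end UlrichChain

end

namespace UlrichChain

section Cotangent

variable {R : Type*} [CommRing R] {I : Ideal R} {ι : Type*} [Fintype ι]

/-- Generators of `I` with no relations modulo `I ^ 2` except those with coefficients in `I` give a
basis of `I / I ^ 2` over `R / I`. -/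
theorem exists_cotangent_basis (w : ι → R) (hspan : I = Ideal.span (Set.range w))
    (hind : ∀ r : ι → R, ∑ j, r j * w j ∈ I ^ 2 → ∀ j, r j ∈ I) :
    Nonempty (Module.Basis ι (R ⧸ I) I.Cotangent) := by
  have hw : ∀ j, w j ∈ I := fun j => hspan ▸ Ideal.subset_span ⟨j, rfl⟩
  let f : ι → I.Cotangent := fun j => I.toCotangent ⟨w j, hw j⟩
  have key : ∀ r : ι → R, ∑ j, (Ideal.Quotient.mk I (r j)) • f j =
      I.toCotangent (∑ j, r j • (⟨w j, hw j⟩ : I)) := by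
    intro r
    rw [map_sum]
    refine Finset.sum_congr rfl fun j _ => ?_
    rw [map_smul]
    exact algebraMap_smul (R ⧸ I) (r j) (f j)
  refine ⟨Module.Basis.mk (v := f) ?_ ?_⟩
  · rw [Fintype.linearIndependent_iff]
    intro g hg
    choose r hr using fun j => Ideal.Quotient.mk_surjective (g j)
    simp only [← hr] at hg ⊢
    rw [key, Ideal.toCotangent_eq_zero] at hg
    intro j
    rw [Ideal.Quotient.eq_zero_iff_mem]
    exact hind r (by simpa using hg) j
  · rintro y -
    obtain ⟨⟨x, hx⟩, rfl⟩ := I.toCotangent_surjective y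
    have hx' := hx
    rw [hspan, Ideal.mem_span_range_iff_exists_fun] at hx'
    obtain ⟨r, hr⟩ := hx'
    have : (⟨x, hx⟩ : I) = ∑ j, r j • (⟨w j, hw j⟩ : I) := by
      ext; simp [← hr]
    rw [this, ← key]
    exact Submodule.sum_mem _ fun j _ => Submodule.smul_mem _ _ (Submodule.subset_span ⟨j, rfl⟩)

theorem embDim_eq_card {S : Type*} [CommRing S] [IsLocalRing S] [IsNoetherianRing S]
    (w : ι → S) (hspan : maximalIdeal S = Ideal.span (Set.range w))
    (hind : ∀ r : ι → S, ∑ j, r j * w j ∈ maximalIdeal S ^ 2 → ∀ j, r j ∈ maximalIdeal S) :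
    embDim S = Fintype.card ι := by
  obtain ⟨b⟩ := exists_cotangent_basis w hspan hind
  rw [embDim, spanFinrank_maximalIdeal_eq_finrank_cotangentSpace]
  exact Module.finrank_eq_card_basis (R := ResidueField S) b

end Cotangent

section MinimalMultiplicity

variable {S : Type*} [CommRing S] [IsLocalRing S] {α : S}

theorem maximalIdeal_pow_succ (hα2 : maximalIdeal S ^ 2 = Ideal.span {α} * maximalIdeal S)
    {k : ℕ} (hk : 1 ≤ k) :
    maximalIdeal S ^ (k + 1) = Ideal.span {α} * maximalIdeal S ^ k := by
  obtain ⟨k, rfl⟩ := Nat.exists_eq_add_of_le hk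
  rw [show 1 + k + 1 = 2 + k by ring, pow_add, hα2, pow_add, pow_one, mul_assoc]

theorem length_quotient_maximalIdeal_pow_one :
    Module.length S (S ⧸ maximalIdeal S ^ 1) = 1 := by
  rw [pow_one, Module.length_eq_one_iff]
  exact isSimpleModule_iff_isCoatom.2 (maximalIdeal.isMaximal S).out

theorem length_quotient_pow_succ (hreg : α ∈ S⁰)
    (hα2 : maximalIdeal S ^ 2 = Ideal.span {α} * maximalIdeal S) {k : ℕ} (hk : 1 ≤ k) :
    Module.length S (S ⧸ maximalIdeal S ^ (k + 1)) =
      Module.length S (S ⧸ maximalIdeal S ^ k) + Module.length S (S ⧸ Ideal.span {α}) := by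
  have hpow := maximalIdeal_pow_succ hα2 hk
  have hle : maximalIdeal S ^ (k + 1) ≤ Ideal.span {α} := hpow ▸ Ideal.mul_le_left
  have hmap : maximalIdeal S ^ k ≤
      Submodule.comap (LinearMap.mulLeft S α) (maximalIdeal S ^ (k + 1)) := by
    intro x hx
    rw [Submodule.mem_comap, hpow]
    exact Ideal.mul_mem_mul (Ideal.mem_span_singleton_self α) hx
  refine Module.length_eq_add_of_exact
    (Submodule.mapQ (maximalIdeal S ^ k) (maximalIdeal S ^ (k + 1)) (LinearMap.mulLeft S α) hmap)
    (Submodule.factor hle) ?_ (Submodule.factor_surjective hle) ?_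
  · rw [← LinearMap.ker_eq_bot, LinearMap.ker_eq_bot']
    intro y hy
    obtain ⟨x, rfl⟩ := Submodule.mkQ_surjective _ y
    rw [Submodule.mkQ_apply, Submodule.mapQ_apply, Submodule.Quotient.mk_eq_zero, hpow,
      LinearMap.mulLeft_apply, Ideal.mem_span_singleton_mul] at hy
    obtain ⟨z, hz, hzx⟩ := hy
    rw [mul_cancel_left_mem_nonZeroDivisors hreg] at hzx
    rw [Submodule.mkQ_apply, Submodule.Quotient.mk_eq_zero]
    exact hzx ▸ hz
  · intro y
    obtain ⟨x, rfl⟩ := Submodule.mkQ_surjective _ y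
    rw [Submodule.factor_mk, Submodule.mkQ_apply, Submodule.mkQ_apply, Submodule.Quotient.mk_eq_zero]
    constructor
    · intro hx
      obtain ⟨z, rfl⟩ := Ideal.mem_span_singleton.1 hx
      exact ⟨Submodule.Quotient.mk z, rfl⟩
    · rintro ⟨z, hz⟩
      obtain ⟨z, rfl⟩ := Submodule.mkQ_surjective _ z
      rw [Submodule.mkQ_apply, Submodule.mapQ_apply, Submodule.Quotient.eq] at hz
      have h1 := hle hz
      rw [LinearMap.mulLeft_apply] at h1
      exact (Submodule.sub_mem_iff_right _
        (Ideal.mul_mem_right z _ (Ideal.mem_span_singleton_self α))).1 h1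

variable [IsNoetherianRing S]

theorem ringKrullDim_eq_one_of_sq_eq (hα : α ∈ maximalIdeal S) (hreg : α ∈ S⁰)
    (hα2 : maximalIdeal S ^ 2 = Ideal.span {α} * maximalIdeal S) : ringKrullDim S = 1 := by
  rw [← ringKrullDim_quotient_span_singleton_succ_eq_ringKrullDim_of_mem_nonZeroDivisors hreg hα]
  have hne : Ideal.span {α} ≠ ⊤ := fun h =>
    (maximalIdeal.isMaximal S).ne_top (top_le_iff.1 (h ▸ (Ideal.span_singleton_le_iff_mem _).2 hα))
  have : Nontrivial (S ⧸ Ideal.span {α}) := Ideal.Quotient.nontrivial_iff.2 hne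
  have : Ring.KrullDimLE 0 (S ⧸ Ideal.span {α}) := by
    rw [Ring.krullDimLE_zero_iff]
    intro P hP
    have hle : maximalIdeal S ≤ P.comap (Ideal.Quotient.mk (Ideal.span {α})) := by
      have hP' : (P.comap (Ideal.Quotient.mk (Ideal.span {α}))).IsPrime := Ideal.comap_isPrime _ _
      refine (hP'.pow_le_iff two_ne_zero).1 ?_
      rw [hα2]
      refine Ideal.mul_le_left.trans ?_
      rw [Ideal.span_singleton_le_iff_mem, Ideal.mem_comap,
        Ideal.Quotient.eq_zero_iff_mem.2 (Ideal.mem_span_singleton_self α)]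
      exact P.zero_mem
    have hmax : (P.comap (Ideal.Quotient.mk (Ideal.span {α}))).IsMaximal := by
      rw [← (maximalIdeal.isMaximal S).eq_of_le (Ideal.comap_ne_top _ hP.ne_top) hle]
      exact maximalIdeal.isMaximal S
    have hmap := Ideal.map_comap_of_surjective _ Ideal.Quotient.mk_surjective P
    have := Ideal.map_eq_top_or_isMaximal_of_surjective
      (Ideal.Quotient.mk (Ideal.span {α})) Ideal.Quotient.mk_surjective hmax
    rw [hmap] at this
    exact this.resolve_left hP.ne_top
  rw [ringKrullDimZero_iff_ringKrullDim_eq_zero.1 this]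
  rfl

theorem isCohenMacaulayLocal_of_sq_eq (hα : α ∈ maximalIdeal S) (hreg : α ∈ S⁰)
    (hα2 : maximalIdeal S ^ 2 = Ideal.span {α} * maximalIdeal S) : IsCohenMacaulayLocal S := by
  refine ⟨inferInstance, [α], by simpa using hα, ?_, ?_⟩
  · rw [IsLocalRing.isRegular_iff_isWeaklyRegular_of_subset_maximalIdeal (by simpa using hα)]
    rw [RingTheory.Sequence.isWeaklyRegular_singleton_iff]
    exact fun x y h => (mul_cancel_left_mem_nonZeroDivisors hreg).1 h
  · rw [ringKrullDim_eq_one_of_sq_eq hα hreg hα2]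
    simp

theorem length_quotient_maximalIdeal_sq :
    Module.length S (S ⧸ maximalIdeal S ^ 2) = embDim S + 1 := by
  have h1 : Module.length S (CotangentSpace S) = embDim S := by
    rw [embDim, spanFinrank_maximalIdeal_eq_finrank_cotangentSpace,
      ← Module.length_eq_finrank (ResidueField S)]
    exact Module.length_eq_of_surjective residue_surjective
  have hle : maximalIdeal S ^ 2 ≤ maximalIdeal S ^ 1 := Ideal.pow_le_pow_right one_le_two
  rw [← h1, ← length_quotient_maximalIdeal_pow_one (S := S)]
  refine Module.length_eq_add_of_exact (maximalIdeal S).cotangentToQuotientSquare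
    (Submodule.factor hle) (Ideal.cotangentToQuotientSquare_injective _)
    (Submodule.factor_surjective hle) ?_
  intro y
  obtain ⟨x, rfl⟩ := Submodule.mkQ_surjective _ y
  rw [Submodule.factor_mk, Submodule.mkQ_apply, Submodule.mkQ_apply, Submodule.Quotient.mk_eq_zero, pow_one]
  constructor
  · intro hx
    exact ⟨(maximalIdeal S).toCotangent ⟨x, hx⟩, Ideal.toCotangent_to_quotient_square _ _⟩
  · rintro ⟨z, hz⟩
    obtain ⟨z, rfl⟩ := Ideal.toCotangent_surjective _ z
    rw [Ideal.toCotangent_to_quotient_square] at hz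
    have h2 := hle ((Submodule.Quotient.eq _).1 hz)
    rw [pow_one] at h2
    exact (Submodule.sub_mem_iff_right _ z.2).1 h2

theorem length_quotient_maximalIdeal_pow (hreg : α ∈ S⁰)
    (hα2 : maximalIdeal S ^ 2 = Ideal.span {α} * maximalIdeal S) (k : ℕ) :
    Module.length S (S ⧸ maximalIdeal S ^ (k + 1)) = ((k * embDim S + 1 : ℕ) : ℕ∞) := by
  have hα1 : Module.length S (S ⧸ Ideal.span {α}) = embDim S := by
    have h := length_quotient_pow_succ hreg hα2 le_rfl
    rw [one_add_one_eq_two, length_quotient_maximalIdeal_sq, length_quotient_maximalIdeal_pow_one,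
      add_comm] at h
    exact ENat.add_right_injective_of_ne_top ENat.one_ne_top h.symm
  induction k with
  | zero => simpa using length_quotient_maximalIdeal_pow_one
  | succ k ih =>
    rw [length_quotient_pow_succ hreg hα2 (Nat.le_add_left 1 k), ih, hα1]
    push_cast
    ring

theorem hasMultiplicity_embDim (hreg : α ∈ S⁰)
    (hα2 : maximalIdeal S ^ 2 = Ideal.span {α} * maximalIdeal S) :
    HasMultiplicity S (embDim S) := by
  have hlim : Tendsto (fun k : ℕ => ENNReal.ofReal ((k * embDim S + 1 : ℝ) / (k + 1))) atTop
      (𝓝 (embDim S : ℝ≥0∞)) := by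
    rw [← ENNReal.ofReal_natCast (embDim S)]
    refine (ENNReal.continuous_ofReal.tendsto _).comp ?_
    have h : Tendsto (fun k : ℕ => (embDim S : ℝ) + (1 - embDim S : ℝ) * (1 / ((k : ℝ) + 1)))
        atTop (𝓝 ((embDim S : ℝ) + (1 - embDim S : ℝ) * 0)) :=
      tendsto_const_nhds.add (tendsto_const_nhds.mul tendsto_one_div_add_atTop_nhds_zero_nat)
    rw [mul_zero, add_zero] at h
    refine h.congr fun k => ?_
    have : (k : ℝ) + 1 ≠ 0 := by positivity
    field_simp
    ring
  rw [HasMultiplicity, ← tendsto_add_atTop_iff_nat 1]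
  refine hlim.congr fun k => ?_
  rw [length_quotient_maximalIdeal_pow hreg hα2, ENNReal.ofReal_div_of_pos (by positivity)]
  congr 1
  · rw [ENat.toENNReal_coe, ← ENNReal.ofReal_natCast]
    push_cast
    rfl
  · rw [← Nat.cast_add_one, ENNReal.ofReal_natCast]

end MinimalMultiplicity

section Series

variable {R : Type*} [CommRing R]

theorem length_quotient_of_covBy {N M : Ideal R} (h : N ⋖ M) :
    Module.length R (R ⧸ N) = Module.length R (R ⧸ M) + 1 := by
  have hs : IsSimpleModule R (M ⧸ N.submoduleOf M) :=
    (covBy_iff_quot_is_simple h.le).1 h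
  rw [add_comm, ← (Module.length_eq_one_iff).2 hs]
  have hcomap : N.submoduleOf M ≤ Submodule.comap M.subtype N := le_rfl
  refine Module.length_eq_add_of_exact (Submodule.mapQ _ N M.subtype hcomap)
    (Submodule.factor h.le) ?_ (Submodule.factor_surjective h.le) ?_
  · rw [← LinearMap.ker_eq_bot, LinearMap.ker_eq_bot']
    intro y hy
    obtain ⟨x, rfl⟩ := Submodule.mkQ_surjective _ y
    rw [Submodule.mkQ_apply, Submodule.mapQ_apply, Submodule.Quotient.mk_eq_zero] at hy
    rw [Submodule.mkQ_apply, Submodule.Quotient.mk_eq_zero]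
    exact hy
  · intro y
    obtain ⟨x, rfl⟩ := Submodule.mkQ_surjective _ y
    rw [Submodule.factor_mk, Submodule.mkQ_apply, Submodule.mkQ_apply, Submodule.Quotient.mk_eq_zero]
    constructor
    · intro hx
      exact ⟨Submodule.Quotient.mk ⟨x, hx⟩, by simp⟩
    · rintro ⟨z, hz⟩
      obtain ⟨z, rfl⟩ := Submodule.mkQ_surjective _ z
      rw [Submodule.mkQ_apply, Submodule.mapQ_apply, Submodule.Quotient.eq] at hz
      exact (Submodule.sub_mem_iff_right _ z.2).1 (h.le hz)

theorem IsCompSeries.length_quotient [IsLocalRing R] {I : Ideal R} {n : ℕ} {d : ℕ → Ideal R}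
    (h : IsCompSeries I n d) {i : ℕ} (h1 : 1 ≤ i) (hi : i ≤ n) :
    Module.length R (R ⧸ d i) = i := by
  induction i, h1 using Nat.le_induction with
  | base =>
    rw [h.first, Nat.cast_one, Module.length_eq_one_iff]
    exact isSimpleModule_iff_isCoatom.2 (maximalIdeal.isMaximal R).out
  | succ i h1 ih =>
    rw [length_quotient_of_covBy (h.covBy i h1 hi), ih (by omega)]
    push_cast
    rfl

theorem IsCompSeries.anti [IsLocalRing R] {I : Ideal R} {n : ℕ} {d : ℕ → Ideal R}
    (h : IsCompSeries I n d) {i j : ℕ} (h1 : 1 ≤ i) (hij : i ≤ j) (hj : j ≤ n) : d j ≤ d i := by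
  induction j, hij using Nat.le_induction with
  | base => exact le_rfl
  | succ j hij ih => exact (h.covBy j (h1.trans hij) hj).le.trans (ih (by omega))

end Series

section UlrichGenerators

variable {R : Type*} [CommRing R] [IsLocalRing R]

theorem IsCohenMacaulayLocal.exists_mem_nonZeroDivisors (hCM : IsCohenMacaulayLocal R)
    (hdim : ringKrullDim R = 1) : ∃ t ∈ maximalIdeal R, t ∈ R⁰ := by
  obtain ⟨-, rs, hrs, hreg, hlen⟩ := hCM
  rw [hdim] at hlen
  have hlen : rs.length = 1 := by exact_mod_cast hlen.symm
  obtain ⟨t, rfl⟩ := List.length_eq_one_iff.1 hlen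
  refine ⟨t, hrs t (by simp), mem_nonZeroDivisors_iff_left.2 fun x hx => ?_⟩
  have h := (RingTheory.Sequence.isWeaklyRegular_singleton_iff R t).1 hreg.toIsWeaklyRegular
  exact h (by simpa using hx)

theorem mem_nonZeroDivisors_of_dvd_pow {R : Type*} [CommRing R] {a t : R} {k : ℕ} (ht : t ∈ R⁰)
    (h : a ∣ t ^ k) : a ∈ R⁰ := by
  obtain ⟨c, hc⟩ := h
  have := pow_mem ht k
  rw [hc] at this
  exact (mul_mem_nonZeroDivisors.1 this).1

/-- An Ulrich ideal has a minimal system of generators which starts with a generator of a principal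
reduction and is a basis modulo `I ^ 2`. -/
theorem IsUlrich.exists_generators [IsNoetherianRing R] (hdim : ringKrullDim R = 1)
    {t : R} (ht : t ∈ maximalIdeal R) (ht0 : t ∈ R⁰) {I : Ideal R} (hI : IsUlrich I) :
    ∃ (a : R) (n : ℕ) (x : Fin (n + 1) → R), a ∈ I ∧ a ∈ R⁰ ∧ I ^ 2 = Ideal.span {a} * I ∧
      (∀ y ∈ I, ∃ (r : R) (s : Fin (n + 1) → R), y = r * a + ∑ j, s j * x j) ∧ (∀ j, x j ∈ I) ∧
      ∀ (r : R) (s : Fin (n + 1) → R), r * a + ∑ j, s j * x j ∈ I ^ 2 → r ∈ I ∧ ∀ j, s j ∈ I := by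
  obtain ⟨hrad, ⟨Q, ⟨hQrad, d, a', hd, hQa⟩, ⟨hQI, -⟩, hne, hsq⟩, hfree⟩ := hI
  have hd1 : d = 1 := by
    rw [hdim] at hd
    exact_mod_cast hd.symm
  subst hd1
  obtain ⟨a, rfl⟩ : ∃ a, Q = Ideal.span {a} := ⟨a' 0, by
    rw [hQa]; congr 1; ext y; simp [Fin.exists_fin_one, eq_comm]⟩
  have haI : a ∈ I := hQI (Ideal.mem_span_singleton_self a)
  have ha0 : a ∈ R⁰ := by
    rw [← hQrad] at ht
    obtain ⟨k, hk⟩ := ht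
    exact mem_nonZeroDivisors_of_dvd_pow ht0 (Ideal.mem_span_singleton.1 hk)
  have hIm : I ≤ maximalIdeal R := hrad ▸ Ideal.le_radical
  have hInt : Nontrivial (R ⧸ I) := Ideal.Quotient.nontrivial_iff.2 fun h =>
    (maximalIdeal.isMaximal R).ne_top (top_le_iff.1 (h ▸ hIm))
  have hfinR : Module.Finite R I.Cotangent :=
    Module.Finite.of_surjective I.toCotangent I.toCotangent_surjective
  have hfin : Module.Finite (R ⧸ I) I.Cotangent := Module.Finite.of_restrictScalars_finite R _ _
  obtain ⟨N, f⟩ : Σ N, Module.Basis (Fin N) (R ⧸ I) I.Cotangent :=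
    ⟨_, Module.finBasis (R ⧸ I) I.Cotangent⟩
  choose y hy using fun j => I.toCotangent_surjective (f j)
  have hlin : ∀ s : Fin N → R, I.toCotangent (∑ j, s j • y j) =
      ∑ j, (Ideal.Quotient.mk I (s j)) • f j := by
    intro s
    rw [map_sum]
    refine Finset.sum_congr rfl fun j _ => ?_
    rw [map_smul, hy]
    exact (algebraMap_smul (R ⧸ I) (s j) (f j)).symm
  have hindep : ∀ s : Fin N → R, ∑ j, s j * (y j : R) ∈ I ^ 2 → ∀ j, s j ∈ I := by
    intro s hs j
    have h0 : I.toCotangent (∑ j, s j • y j) = 0 := by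
      rw [Ideal.toCotangent_eq_zero]
      simpa using hs
    rw [hlin] at h0
    have := Fintype.linearIndependent_iff.1 f.linearIndependent _ h0 j
    rwa [Ideal.Quotient.eq_zero_iff_mem] at this
  have hspan : ∀ z ∈ I, ∃ s : Fin N → R, z - ∑ j, s j * (y j : R) ∈ I ^ 2 := by
    intro z hz
    choose s hs using fun j => Ideal.Quotient.mk_surjective (f.repr (I.toCotangent ⟨z, hz⟩) j)
    refine ⟨s, ?_⟩
    have h0 : I.toCotangent ⟨z, hz⟩ = I.toCotangent (∑ j, s j • y j) := by
      rw [hlin]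
      simp only [hs]
      exact (f.sum_repr _).symm
    rw [Ideal.toCotangent_eq] at h0
    simpa using h0
  obtain ⟨c, hc⟩ := hspan a haI
  have hI2 : I ^ 2 ≤ maximalIdeal R * I := by
    rw [sq]
    exact Ideal.mul_mono_left hIm
  -- some coefficient of `a` is a unit
  obtain ⟨p, hp⟩ : ∃ p, c p ∉ maximalIdeal R := by
    by_contra! hcon
    have ham : a ∈ maximalIdeal R * I := by
      rw [← sub_add_cancel a (∑ j, c j * (y j : R))]
      exact add_mem (hI2 hc) (Ideal.sum_mem _ fun j _ => Ideal.mul_mem_mul (hcon j) (y j).2)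
    have hle : I ^ 2 ≤ maximalIdeal R • I ^ 2 := by
      conv_lhs => rw [hsq]
      rw [sq, smul_eq_mul, ← mul_assoc]
      exact Ideal.mul_mono_left ((Ideal.span_singleton_le_iff_mem _).2 ham)
    have hbot := Submodule.eq_bot_of_le_smul_of_le_jacobson_bot _ _
      (IsNoetherian.noetherian (I ^ 2)) hle (maximalIdeal_le_jacobson ⊥)
    have haa : a ^ 2 ∈ I ^ 2 := Ideal.pow_mem_pow haI 2
    rw [hbot, Submodule.mem_bot] at haa
    have := pow_mem ha0 2
    rw [haa] at this
    exact zero_ne_one (mem_nonZeroDivisors_iff_left.1 this 1 (by simp)).symm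
  obtain ⟨u, hu⟩ : IsUnit (c p) := by simpa using hp
  obtain ⟨M, rfl⟩ : ∃ M, N = M + 1 := ⟨N - 1, by have := p.pos; omega⟩
  let x : Fin M → R := fun j => y (p.succAbove j)
  have hxI : ∀ j, x j ∈ I := fun j => (y _).2
  have hind : ∀ (r : R) (s : Fin M → R), r * a + ∑ j, s j * x j ∈ I ^ 2 → r ∈ I ∧ ∀ j, s j ∈ I := by
    intro r s hrs
    have h1 : ∑ j, (r * c j + (p.insertNth (0 : R) s : Fin (M + 1) → R) j) * (y j : R) ∈ I ^ 2 := by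
      have h2 := Ideal.mul_mem_left _ r hc
      have h3 := sub_mem hrs h2
      convert h3 using 1
      simp only [add_mul, Finset.sum_add_distrib, mul_assoc, ← Finset.mul_sum]
      rw [p.sum_univ_succAbove fun j => (p.insertNth (0 : R) s : Fin (M + 1) → R) j * (y j : R)]
      simp [x]
      ring
    have h2 := hindep _ h1
    have hr : r ∈ I := by
      have := h2 p
      rw [Fin.insertNth_apply_same, add_zero, ← hu] at this
      simpa using Ideal.mul_mem_right ((u⁻¹ : Rˣ) : R) _ this
    refine ⟨hr, fun j => ?_⟩
    have := h2 (p.succAbove j)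
    rw [Fin.insertNth_apply_succAbove] at this
    exact (Submodule.add_mem_iff_right _ (Ideal.mul_mem_right _ _ hr)).1 this
  have hgen : ∀ y ∈ I, ∃ (r : R) (s : Fin M → R), y = r * a + ∑ j, s j * x j := by
    have hle : I ≤ Ideal.span {a} ⊔ Ideal.span (Set.range x) := by
      refine Submodule.le_of_le_smul_of_le_jacobson_bot (IsNoetherian.noetherian I)
        (maximalIdeal_le_jacobson ⊥) ?_
      have ha' : a ∈ Ideal.span {a} ⊔ Ideal.span (Set.range x) ⊔ maximalIdeal R • I :=
        Ideal.mem_sup_left (Ideal.mem_sup_left (Ideal.mem_span_singleton_self a))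
      have hx' : ∀ j, x j ∈ Ideal.span {a} ⊔ Ideal.span (Set.range x) ⊔ maximalIdeal R • I :=
        fun j => Ideal.mem_sup_left (Ideal.mem_sup_right (Ideal.subset_span ⟨j, rfl⟩))
      have hI2' : ∀ z ∈ I ^ 2, z ∈ Ideal.span {a} ⊔ Ideal.span (Set.range x) ⊔ maximalIdeal R • I :=
        fun z hz => Ideal.mem_sup_right (hI2 hz)
      have hy' : ∀ j, (y j : R) ∈
          Ideal.span {a} ⊔ Ideal.span (Set.range x) ⊔ maximalIdeal R • I := by
        intro j
        rcases p.eq_self_or_eq_succAbove j with rfl | ⟨j, rfl⟩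
        · have h1 := sub_mem (sub_mem ha' (hI2' _ hc))
            (Ideal.sum_mem _ fun i (_ : i ∈ Finset.univ) =>
              Ideal.mul_mem_left _ (c (j.succAbove i)) (hx' i))
          rw [sub_sub_cancel, j.sum_univ_succAbove, add_sub_cancel_right, ← hu] at h1
          simpa using Ideal.mul_mem_left _ ((u⁻¹ : Rˣ) : R) h1
        · exact hx' j
      intro z hz
      obtain ⟨s, hs⟩ := hspan z hz
      rw [← sub_add_cancel z (∑ j, s j * (y j : R))]
      exact add_mem (hI2' _ hs) (Ideal.sum_mem _ fun j _ => Ideal.mul_mem_left _ _ (hy' j))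
    intro z hz
    obtain ⟨z₁, h₁, z₂, h₂, rfl⟩ := Submodule.mem_sup.1 (hle hz)
    obtain ⟨r, rfl⟩ := Ideal.mem_span_singleton'.1 h₁
    obtain ⟨s, rfl⟩ := Ideal.mem_span_range_iff_exists_fun.1 h₂
    exact ⟨r, s, rfl⟩
  obtain ⟨n, rfl⟩ : ∃ n, M = n + 1 := by
    rcases M with _ | n
    · refine absurd (le_antisymm ?_ hQI) hne
      intro z hz
      obtain ⟨r, s, rfl⟩ := hgen z hz
      simpa using Ideal.mul_mem_left _ r (Ideal.mem_span_singleton_self a)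
    · exact ⟨n, rfl⟩
  exact ⟨a, n, x, haI, ha0, hsq, hgen, hxI, hind⟩

end UlrichGenerators

section Datum

variable {R : Type*} [CommRing R]

/-- If `I` is an ideal over which the maximal ideal is generated by `α`, then `α ^ p r ∈ I`
implies `r ∈ (α ^ q) + I` as long as `p + q` is at most the nilpotency order of `α` modulo `I`. -/
theorem mem_sup_of_pow_mul_mem [IsLocalRing R] {α : R} {I : Ideal R} {ℓ : ℕ}
    (hmax : maximalIdeal R = Ideal.span {α} ⊔ I) (hℓ : ∀ i < ℓ, α ^ i ∉ I) {p q : ℕ}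
    (hpq : p + q ≤ ℓ) {r : R} (hr : α ^ p * r ∈ I) : r ∈ Ideal.span {α ^ q} ⊔ I := by
  induction q with
  | zero => simp
  | succ q ih =>
    obtain ⟨y, hy, z, hz, rfl⟩ := Submodule.mem_sup.1 (ih (by omega))
    obtain ⟨s, rfl⟩ := Ideal.mem_span_singleton'.1 hy
    have h1 : α ^ (p + q) * s ∈ I := by
      have := sub_mem hr (Ideal.mul_mem_left _ (α ^ p) hz)
      convert this using 1
      ring
    have hs : s ∈ maximalIdeal R := by
      by_contra hs
      obtain ⟨u, rfl⟩ : IsUnit s := by simpa using hs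
      refine hℓ (p + q) (by omega) ?_
      simpa using Ideal.mul_mem_right ((u⁻¹ : Rˣ) : R) _ h1
    rw [hmax] at hs
    obtain ⟨y', hy', z', hz', rfl⟩ := Submodule.mem_sup.1 hs
    obtain ⟨s, rfl⟩ := Ideal.mem_span_singleton'.1 hy'
    refine Submodule.mem_sup.2 ⟨s * α ^ (q + 1), Ideal.mul_mem_left _ _
      (Ideal.mem_span_singleton_self _), z' * α ^ q + z,
      add_mem (Ideal.mul_mem_right _ _ hz') hz, by ring⟩

variable {K : Type*} [CommRing K] [Algebra R K]

/-- An overring `B = R + ∑ R b_j` of `R` with `I = α ^ ℓ B`, such that `1, b_1, …, b_n` is a basis of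
`B / I` over `R / I` and `α` generates the maximal ideal of `R / I`, where `ℓ` is the nilpotency
order of `α` in `R / I`. -/
structure IsFreeOverring [IsLocalRing R] (α : R) (ℓ : ℕ) (I : Ideal R) (B : Subalgebra R K) {n : ℕ}
    (b : Fin n → K) : Prop where
  maximalIdeal_eq : maximalIdeal R = Ideal.span {α} ⊔ I
  pow_mem : α ^ ℓ ∈ I
  pow_notMem : ∀ i < ℓ, α ^ i ∉ I
  mem_iff : ∀ y, y ∈ B ↔
    ∃ (r : R) (s : Fin n → R), y = algebraMap R K r + ∑ j, algebraMap R K (s j) * b j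
  exists_mul : ∀ x ∈ I, ∃ y ∈ B, algebraMap R K x = algebraMap R K α ^ ℓ * y
  exists_mem : ∀ y ∈ B, ∃ x ∈ I, algebraMap R K x = algebraMap R K α ^ ℓ * y
  indep : ∀ (r : R) (s : Fin n → R), ∀ z ∈ I,
    algebraMap R K r + ∑ j, algebraMap R K (s j) * b j = algebraMap R K z → r ∈ I ∧ ∀ j, s j ∈ I

variable [IsFractionRing R K]

theorem algebraMap_mul_cancel {α : R} (hα : α ∈ R⁰) {x y : K}
    (h : algebraMap R K α * x = algebraMap R K α * y) : x = y :=
  (IsLocalization.map_units K (⟨α, hα⟩ : R⁰)).mul_left_cancel h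

variable [IsLocalRing R] [IsNoetherianRing R]

variable (K) in
theorem exists_isFreeOverring {α : R} (hα : α ∈ maximalIdeal R) (hα0 : α ∈ R⁰)
    (hα2 : maximalIdeal R ^ 2 = Ideal.span {α} * maximalIdeal R) {I : Ideal R}
    (hIm : I ≤ maximalIdeal R) (hαI : ∃ k, α ^ k ∈ I)
    {a : R} {n : ℕ} {x : Fin (n + 1) → R} (haI : a ∈ I) (ha0 : a ∈ R⁰)
    (hsq : I ^ 2 = Ideal.span {a} * I)
    (hgen : ∀ y ∈ I, ∃ (r : R) (s : Fin (n + 1) → R), y = r * a + ∑ j, s j * x j)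
    (hxI : ∀ j, x j ∈ I)
    (hind : ∀ (r : R) (s : Fin (n + 1) → R), r * a + ∑ j, s j * x j ∈ I ^ 2 →
      r ∈ I ∧ ∀ j, s j ∈ I) :
    ∃ (ℓ : ℕ) (B : Subalgebra R K) (b : Fin (n + 1) → K), IsFreeOverring α ℓ I B b := by
  have hinj : Function.Injective (algebraMap R K) := IsFractionRing.injective R K
  let B : Subalgebra R K := selfColon (IsLocalization.coeSubmodule K I)
  have hIB : ∀ y ∈ B, ∀ w ∈ I, ∃ z ∈ I, algebraMap R K z = y * algebraMap R K w := by
    intro y hy w hw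
    exact (IsLocalization.mem_coeSubmodule K I).1
      (hy _ ((IsLocalization.mem_coeSubmodule K I).2 ⟨w, hw, rfl⟩))
  have hB : ∀ y z, z ∈ I → algebraMap R K z = y * algebraMap R K a → y ∈ B := by
    intro y z hz hyz w' hw'
    obtain ⟨w, hw, rfl⟩ := (IsLocalization.mem_coeSubmodule K I).1 hw'
    have hzw : z * w ∈ I ^ 2 := by
      rw [sq]
      exact Ideal.mul_mem_mul hz hw
    rw [hsq, Ideal.mem_span_singleton_mul] at hzw
    obtain ⟨w', hw', h⟩ := hzw
    refine (IsLocalization.mem_coeSubmodule K I).2 ⟨w', hw', algebraMap_mul_cancel ha0 ?_⟩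
    rw [← map_mul, h, map_mul, hyz]
    ring
  let b : Fin (n + 1) → K := fun j => IsLocalization.mk' K (x j) (⟨a, ha0⟩ : R⁰)
  have hb : ∀ j, b j * algebraMap R K a = algebraMap R K (x j) := fun j =>
    IsLocalization.mk'_spec K (x j) (⟨a, ha0⟩ : R⁰)
  have hcomb : ∀ (r : R) (s : Fin (n + 1) → R),
      (algebraMap R K r + ∑ j, algebraMap R K (s j) * b j) * algebraMap R K a =
        algebraMap R K (r * a + ∑ j, s j * x j) := by
    intro r s
    rw [add_mul, Finset.sum_mul, map_add, map_mul, map_sum]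
    simp only [mul_assoc, hb, map_mul]
  have hmem : ∀ y, y ∈ B ↔
      ∃ (r : R) (s : Fin (n + 1) → R), y = algebraMap R K r + ∑ j, algebraMap R K (s j) * b j := by
    intro y
    constructor
    · intro hy
      obtain ⟨z, hz, hzy⟩ := hIB y hy a haI
      obtain ⟨r, s, rfl⟩ := hgen z hz
      refine ⟨r, s, algebraMap_mul_cancel ha0 ?_⟩
      rw [mul_comm, ← hzy, ← hcomb, mul_comm]
    · rintro ⟨r, s, rfl⟩
      exact hB _ _ (add_mem (Ideal.mul_mem_left _ _ haI)
        (Ideal.sum_mem _ fun j _ => Ideal.mul_mem_left _ _ (hxI j))) (hcomb r s).symm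
  have hindep : ∀ (r : R) (s : Fin (n + 1) → R), ∀ z ∈ I,
      algebraMap R K r + ∑ j, algebraMap R K (s j) * b j = algebraMap R K z →
        r ∈ I ∧ ∀ j, s j ∈ I := by
    intro r s z hz h
    refine hind r s ?_
    have h1 : r * a + ∑ j, s j * x j = z * a := by
      apply hinj
      rw [← hcomb, h, map_mul]
    rw [h1, sq]
    exact Ideal.mul_mem_mul hz haI
  have hcolon : ∀ y : K, (∀ w ∈ I, ∃ z, algebraMap R K z = y * algebraMap R K w) → y ∈ B := by
    intro y hy
    obtain ⟨z, hz⟩ := hy a haI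
    refine hB y z ?_ hz
    obtain ⟨w, hw⟩ := hy (x 0) (hxI 0)
    have h1 : algebraMap R K (-w) + ∑ j, algebraMap R K ((Pi.single 0 z : Fin (n + 1) → R) j) * b j
        = algebraMap R K 0 := by
      rw [Finset.sum_eq_single 0 (fun j _ hj => by simp [hj]) (by simp), Pi.single_eq_same,
        map_neg, map_zero, hw, hz, mul_assoc, mul_comm (algebraMap R K a), hb]
      ring
    simpa using (hindep _ _ 0 I.zero_mem h1).2 0
  have hdiv : ∀ w ∈ maximalIdeal R, ∃ y ∈ B, algebraMap R K w = algebraMap R K α * y := by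
    intro w hw
    have hspec := IsLocalization.mk'_spec K w (⟨α, hα0⟩ : R⁰)
    refine ⟨IsLocalization.mk' K w (⟨α, hα0⟩ : R⁰), hcolon _ fun v hv => ?_, ?_⟩
    · have hwv : w * v ∈ maximalIdeal R ^ 2 := by
        rw [sq]
        exact Ideal.mul_mem_mul hw (hIm hv)
      rw [hα2, Ideal.mem_span_singleton_mul] at hwv
      obtain ⟨z, -, hz⟩ := hwv
      refine ⟨z, algebraMap_mul_cancel hα0 ?_⟩
      rw [← map_mul, hz, map_mul, ← hspec]
      ring
    · rw [mul_comm]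
      exact hspec.symm
  have hmax : maximalIdeal R = Ideal.span {α} ⊔ I := by
    refine le_antisymm (fun w hw => ?_) (sup_le ((Ideal.span_singleton_le_iff_mem _).2 hα) hIm)
    obtain ⟨y, hy, hwy⟩ := hdiv w hw
    obtain ⟨r, s, rfl⟩ := (hmem y).1 hy
    have hys : ∀ j, α * s j ∈ I := by
      intro j
      have := (hindep (α * r - w) (fun j => α * s j) 0 I.zero_mem (by
        rw [map_sub, hwy, mul_add, Finset.mul_sum, map_mul, map_zero]
        simp only [map_mul, mul_assoc]
        ring)).2 j
      exact this
    have hbB : ∀ j, b j ∈ B := fun j => hB _ _ (hxI j) (hb j).symm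
    choose z hz hzs using fun j => hIB (b j) (hbB j) (α * s j) (hys j)
    refine Submodule.mem_sup.2 ⟨α * r, Ideal.mul_mem_right _ _ (Ideal.mem_span_singleton_self α),
      ∑ j, z j, Ideal.sum_mem _ fun j _ => hz j, hinj ?_⟩
    rw [hwy, map_add, map_sum, mul_add, map_mul, Finset.mul_sum]
    simp only [hzs, map_mul]
    congr 1
    exact Finset.sum_congr rfl fun j _ => by ring
  classical
  obtain ⟨ℓ, hℓI, hℓ⟩ : ∃ ℓ, α ^ ℓ ∈ I ∧ ∀ i < ℓ, α ^ i ∉ I :=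
    ⟨Nat.find hαI, Nat.find_spec hαI, fun i hi => Nat.find_min hαI hi⟩
  have hℓ1 : 1 ≤ ℓ := by
    rcases ℓ with _ | ℓ
    · rw [pow_zero] at hℓI
      exact absurd (hIm hℓI) ((Ideal.ne_top_iff_one _).1 (maximalIdeal.isMaximal R).ne_top)
    · omega
  refine ⟨ℓ, B, b, hmax, hℓI, hℓ, hmem, ?_, ?_, hindep⟩
  · let N : Ideal R :=
      (B.toSubmodule.map (LinearMap.mulLeft R (algebraMap R K α ^ ℓ))).comap (Algebra.linearMap R K)
    have hN : ∀ w, w ∈ N ↔ ∃ y ∈ B, algebraMap R K α ^ ℓ * y = algebraMap R K w := by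
      intro w
      simp [N]
    suffices h : I ≤ N by
      intro w hw
      obtain ⟨y, hy, h⟩ := (hN w).1 (h hw)
      exact ⟨y, hy, h.symm⟩
    refine Submodule.le_of_le_smul_of_le_jacobson_bot (IsNoetherian.noetherian I)
      (maximalIdeal_le_jacobson ⊥) fun w hw => ?_
    obtain ⟨y, hy, hwy⟩ := hdiv w (hIm hw)
    obtain ⟨r, s, rfl⟩ := (hmem y).1 hy
    obtain ⟨hr, hs⟩ := hindep (α * r) (fun j => α * s j) w hw (by
      rw [hwy, mul_add, Finset.mul_sum, map_mul]
      simp only [map_mul, mul_assoc])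
    have hlift : ∀ r, α * r ∈ I → ∃ t, ∃ z ∈ I, r = t * α ^ (ℓ - 1) + z := by
      intro r hr
      obtain ⟨t, ht, z, hz, rfl⟩ := Submodule.mem_sup.1
        (mem_sup_of_pow_mul_mem hmax hℓ (p := 1) (q := ℓ - 1) (by omega) (by simpa using hr))
      obtain ⟨t, rfl⟩ := Ideal.mem_span_singleton'.1 ht
      exact ⟨t, z, hz, rfl⟩
    obtain ⟨r', z', hz', rfl⟩ := hlift r hr
    choose s' z hz hsz using fun j => hlift (s j) (hs j)
    have hbB : ∀ j, b j ∈ B := fun j => hB _ _ (hxI j) (hb j).symm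
    choose v hv hvz using fun j => hIB (b j) (hbB j) (z j) (hz j)
    have hy' : algebraMap R K r' + ∑ j, algebraMap R K (s' j) * b j ∈ B := (hmem _).2 ⟨r', s', rfl⟩
    obtain ⟨g, hg, hgy⟩ := hIB _ hy' _ hℓI
    refine Submodule.mem_sup.2 ⟨g, (hN g).2 ⟨_, hy', by rw [hgy, map_pow, mul_comm]⟩,
      α * (z' + ∑ j, v j), Submodule.smul_mem_smul hα (add_mem hz' (Ideal.sum_mem _ fun j _ => hv j)),
      hinj ?_⟩
    have hpow : algebraMap R K α ^ ℓ = algebraMap R K α * algebraMap R K α ^ (ℓ - 1) := by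
      rw [← pow_succ', Nat.sub_add_cancel hℓ1]
    rw [hwy, map_add, hgy, map_mul, map_add, map_add, map_sum, map_mul, map_pow, map_pow, hpow]
    simp only [hsz, hvz, map_add, map_mul, map_pow, add_mul, Finset.sum_add_distrib, mul_add,
      Finset.mul_sum, Finset.sum_mul]
    have e1 : ∀ j, algebraMap R K (s' j) * b j * (algebraMap R K α * algebraMap R K α ^ (ℓ - 1)) =
      algebraMap R K α * (algebraMap R K (s' j) * algebraMap R K α ^ (ℓ - 1) * b j) := fun j => by
        ring
    have e2 : ∀ j, algebraMap R K α * (b j * algebraMap R K (z j)) =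
      algebraMap R K α * (algebraMap R K (z j) * b j) := fun j => by ring
    simp only [e1, e2]
    ring
  · intro y hy
    obtain ⟨z, hz, h⟩ := hIB y hy _ hℓI
    exact ⟨z, hz, by rw [h, map_pow, mul_comm]⟩

end Datum

section Tower

variable {R : Type*} [CommRing R] {K : Type*} [CommRing K] [Algebra R K]

/-- The subring `R + α ^ q B` of `B`. -/
def addPowMul (B : Subalgebra R K) (α : R) (q : ℕ) : Subalgebra R K where
  carrier := {y | ∃ r : R, ∃ z ∈ B, y = algebraMap R K r + algebraMap R K α ^ q * z}
  mul_mem' := by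
    rintro _ _ ⟨r, z, hz, rfl⟩ ⟨r', z', hz', rfl⟩
    refine ⟨r * r', algebraMap R K r * z' + algebraMap R K r' * z +
      algebraMap R K α ^ q * (z * z'), ?_, ?_⟩
    · have := B.algebraMap_mem
      exact add_mem (add_mem (mul_mem (this _) hz') (mul_mem (this _) hz))
        (mul_mem (pow_mem (this _) _) (mul_mem hz hz'))
    · rw [map_mul]
      ring
  add_mem' := by
    rintro _ _ ⟨r, z, hz, rfl⟩ ⟨r', z', hz', rfl⟩
    refine ⟨r + r', z + z', add_mem hz hz', ?_⟩
    rw [map_add]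
    ring
  algebraMap_mem' r := ⟨r, 0, B.zero_mem, by simp⟩

theorem addPowMul_le (B : Subalgebra R K) (α : R) (q : ℕ) : addPowMul B α q ≤ B := by
  rintro _ ⟨r, z, hz, rfl⟩
  exact add_mem (B.algebraMap_mem _) (mul_mem (pow_mem (B.algebraMap_mem _) _) hz)

theorem pow_mul_mem_addPowMul {B : Subalgebra R K} {α : R} {q p : ℕ} (hqp : q ≤ p) {z : K}
    (hz : z ∈ B) : algebraMap R K α ^ p * z ∈ addPowMul B α q := by
  refine ⟨0, algebraMap R K α ^ (p - q) * z, mul_mem (pow_mem (B.algebraMap_mem _) _) hz, ?_⟩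
  rw [map_zero, zero_add, ← mul_assoc, ← pow_add, Nat.add_sub_cancel' hqp]

theorem addPowMul_anti (B : Subalgebra R K) (α : R) {q p : ℕ} (hqp : q ≤ p) :
    addPowMul B α p ≤ addPowMul B α q := by
  rintro _ ⟨r, z, hz, rfl⟩
  exact add_mem (Subalgebra.algebraMap_mem _ _) (pow_mul_mem_addPowMul hqp hz)

theorem selfColon_eq_of_mem_iff {M : Submodule R K} {T : Subalgebra R K} {t : K} (ht : IsUnit t)
    (hM : ∀ y, y ∈ M ↔ ∃ z ∈ T, y = t * z) : selfColon M = T := by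
  ext y
  constructor
  · intro hy
    obtain ⟨z, hz, h⟩ := (hM _).1 (hy t ((hM t).2 ⟨1, T.one_mem, (mul_one t).symm⟩))
    rw [mul_comm, ht.mul_right_inj] at h
    exact h ▸ hz
  · intro hy w hw
    obtain ⟨z, hz, rfl⟩ := (hM w).1 hw
    exact (hM _).2 ⟨y * z, mul_mem hy hz, by ring⟩

theorem le_integralClosure_of_finite (T : Subalgebra R K) [Module.Finite R T] :
    T ≤ integralClosure R K := fun x hx =>
  (Algebra.IsIntegral.isIntegral (R := R) (⟨x, hx⟩ : T)).map T.val

theorem algebraMap_mem_jacobson_bot [IsLocalRing R] {α : R} (hα : α ∈ maximalIdeal R)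
    (T : Type*) [CommRing T] [Algebra R T] [Module.Finite R T] :
    algebraMap R T α ∈ Ideal.jacobson (⊥ : Ideal T) := by
  rw [Ideal.jacobson, Ideal.mem_sInf]
  rintro M ⟨-, hM⟩
  have h := Ideal.isMaximal_comap_of_isIntegral_of_isMaximal (R := R) M
  rw [← Ideal.mem_comap, eq_maximalIdeal h]
  exact hα

variable [IsLocalRing R] {α : R} {ℓ : ℕ} {I : Ideal R} {B : Subalgebra R K} {n : ℕ} {b : Fin n → K}

namespace IsFreeOverring

theorem ideal_le (h : IsFreeOverring α ℓ I B b) : I ≤ maximalIdeal R :=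
  h.maximalIdeal_eq ▸ le_sup_right

theorem mem_maximalIdeal (h : IsFreeOverring α ℓ I B b) : α ∈ maximalIdeal R :=
  h.maximalIdeal_eq ▸ Ideal.mem_sup_left (Ideal.mem_span_singleton_self α)

theorem one_le (h : IsFreeOverring α ℓ I B b) : 1 ≤ ℓ := by
  rcases ℓ with _ | ℓ
  · have := h.pow_mem
    rw [pow_zero] at this
    exact absurd (h.ideal_le this) ((Ideal.ne_top_iff_one _).1 (maximalIdeal.isMaximal R).ne_top)
  · omega

theorem basis_mem (h : IsFreeOverring α ℓ I B b) (j : Fin n) : b j ∈ B := by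
  classical
  refine (h.mem_iff _).2 ⟨0, Pi.single j 1, ?_⟩
  rw [Finset.sum_eq_single j (fun i _ hi => by simp [hi]) (by simp)]
  simp

/-! ### The ideals between `I` and the maximal ideal -/

theorem le_or_le (h : IsFreeOverring α ℓ I B b) {J : Ideal R} {i : ℕ} (hIJ : I ≤ J)
    (hJ : J ≤ Ideal.span {α ^ i} ⊔ I) :
    J ≤ Ideal.span {α ^ (i + 1)} ⊔ I ∨ J = Ideal.span {α ^ i} ⊔ I := by
  by_cases hle : J ≤ Ideal.span {α ^ (i + 1)} ⊔ I
  · exact Or.inl hle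
  refine Or.inr (le_antisymm hJ (sup_le ?_ hIJ))
  obtain ⟨x, hxJ, hx⟩ := Set.not_subset.1 hle
  obtain ⟨y, hy, z, hz, rfl⟩ := Submodule.mem_sup.1 (hJ hxJ)
  obtain ⟨s, rfl⟩ := Ideal.mem_span_singleton'.1 hy
  have hs : s ∉ maximalIdeal R := by
    intro hs
    rw [h.maximalIdeal_eq] at hs
    obtain ⟨y', hy', z', hz', rfl⟩ := Submodule.mem_sup.1 hs
    obtain ⟨s, rfl⟩ := Ideal.mem_span_singleton'.1 hy'
    exact hx (Submodule.mem_sup.2 ⟨s * α ^ (i + 1), Ideal.mul_mem_left _ _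
      (Ideal.mem_span_singleton_self _), z' * α ^ i + z,
      add_mem (Ideal.mul_mem_right _ _ hz') hz, by ring⟩)
  obtain ⟨u, rfl⟩ : IsUnit s := by simpa using hs
  rw [Ideal.span_singleton_le_iff_mem]
  have := Ideal.mul_mem_left _ ((u⁻¹ : Rˣ) : R) ((Submodule.add_mem_iff_left _ (hIJ hz)).1 hxJ)
  simpa using this

theorem sup_last (h : IsFreeOverring α ℓ I B b) : Ideal.span {α ^ ℓ} ⊔ I = I :=
  sup_eq_right.2 ((Ideal.span_singleton_le_iff_mem _).2 h.pow_mem)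

theorem eq_sup_of_le (h : IsFreeOverring α ℓ I B b) {J : Ideal R} (hIJ : I ≤ J)
    (hJ : J ≤ maximalIdeal R) : ∃ i, 1 ≤ i ∧ i ≤ ℓ ∧ J = Ideal.span {α ^ i} ⊔ I := by
  by_contra! hcon
  have hle : ∀ i, 1 ≤ i → i ≤ ℓ → J ≤ Ideal.span {α ^ i} ⊔ I := by
    intro i h1 hi
    induction i, h1 using Nat.le_induction with
    | base => rwa [pow_one, ← h.maximalIdeal_eq]
    | succ i h1 ih =>
      exact (h.le_or_le hIJ (ih (by omega))).resolve_right (hcon i h1 (by omega))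
  refine hcon ℓ h.one_le le_rfl (le_antisymm (hle ℓ h.one_le le_rfl) ?_)
  rwa [h.sup_last]

theorem pow_notMem_sup (h : IsFreeOverring α ℓ I B b) {i : ℕ} (hi : i < ℓ) :
    α ^ i ∉ Ideal.span {α ^ (i + 1)} ⊔ I := by
  intro hmem
  obtain ⟨y, hy, z, hz, hyz⟩ := Submodule.mem_sup.1 hmem
  obtain ⟨s, rfl⟩ := Ideal.mem_span_singleton'.1 hy
  have hu : IsUnit (1 - s * α) := by
    have := Ideal.mul_mem_left _ s h.mem_maximalIdeal
    rw [← IsLocalRing.notMem_maximalIdeal]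
    intro h1
    exact (Ideal.ne_top_iff_one _).1 (maximalIdeal.isMaximal R).ne_top
      ((Submodule.sub_mem_iff_left _ this).1 h1)
  obtain ⟨u, hu⟩ := hu
  refine h.pow_notMem i hi ?_
  have h1 : α ^ i * (u : R) ∈ I := by
    rw [hu]
    convert hz using 1
    rw [← sub_eq_zero] at hyz ⊢
    rw [← neg_eq_zero, ← hyz]
    ring
  simpa using Ideal.mul_mem_right ((u⁻¹ : Rˣ) : R) _ h1

theorem sup_covBy (h : IsFreeOverring α ℓ I B b) {i : ℕ} (hi : i < ℓ) :
    Ideal.span {α ^ (i + 1)} ⊔ I ⋖ Ideal.span {α ^ i} ⊔ I := by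
  have hle : Ideal.span {α ^ (i + 1)} ⊔ I ≤ Ideal.span {α ^ i} ⊔ I := by
    refine sup_le_sup_right ?_ _
    rw [Ideal.span_singleton_le_span_singleton]
    exact pow_dvd_pow _ (Nat.le_succ i)
  refine ⟨lt_of_le_not_ge hle fun hge => h.pow_notMem_sup hi
    (hge (Ideal.mem_sup_left (Ideal.mem_span_singleton_self _))), fun J h1 h2 => ?_⟩
  rcases h.le_or_le (le_sup_right.trans h1.le) h2.le with h3 | h3
  · exact h1.not_ge h3
  · exact h2.ne h3

theorem isCompSeries (h : IsFreeOverring α ℓ I B b) :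
    IsCompSeries I ℓ fun i => Ideal.span {α ^ i} ⊔ I where
  one_le := h.one_le
  first := by rw [pow_one, h.maximalIdeal_eq]
  last := h.sup_last
  covBy _ _ hi := h.sup_covBy hi

theorem eq_of_isCompSeries (h : IsFreeOverring α ℓ I B b) {m : ℕ} {d : ℕ → Ideal R}
    (hd : IsCompSeries I m d) : m = ℓ ∧ ∀ i, 1 ≤ i → i ≤ ℓ → d i = Ideal.span {α ^ i} ⊔ I := by
  have hm : m = ℓ := by
    have h1 := hd.length_quotient hd.one_le le_rfl
    have h2 := h.isCompSeries.length_quotient h.one_le le_rfl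
    beta_reduce at h2
    rw [h.sup_last] at h2
    rw [hd.last, h2] at h1
    exact_mod_cast h1.symm
  subst hm
  refine ⟨rfl, fun i h1 hi => ?_⟩
  obtain ⟨k, hk1, hk, hdk⟩ := h.eq_sup_of_le (hd.last ▸ hd.anti h1 hi le_rfl)
    (hd.first ▸ hd.anti le_rfl h1 hi)
  have e1 := hd.length_quotient h1 hi
  have e2 := h.isCompSeries.length_quotient hk1 hk
  beta_reduce at e2
  rw [← hdk, e1] at e2
  have : i = k := by exact_mod_cast e2
  exact this ▸ hdk

/-! ### The tower of overrings -/

theorem addPowMul_last (h : IsFreeOverring α ℓ I B b) : addPowMul B α ℓ = ⊥ := by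
  refine le_bot_iff.1 ?_
  rintro _ ⟨r, z, hz, rfl⟩
  obtain ⟨x, -, hx⟩ := h.exists_mem z hz
  rw [← hx, ← map_add]
  exact Subalgebra.algebraMap_mem _ _

theorem mem_coeSubmodule_sup (h : IsFreeOverring α ℓ I B b) {i : ℕ} (hi : i ≤ ℓ) (y : K) :
    y ∈ IsLocalization.coeSubmodule K (Ideal.span {α ^ i} ⊔ I) ↔
      ∃ z ∈ addPowMul B α (ℓ - i), y = algebraMap R K α ^ i * z := by
  rw [IsLocalization.mem_coeSubmodule]
  constructor
  · rintro ⟨x, hx, rfl⟩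
    obtain ⟨y, hy, z, hz, rfl⟩ := Submodule.mem_sup.1 hx
    obtain ⟨s, rfl⟩ := Ideal.mem_span_singleton'.1 hy
    obtain ⟨w, hw, hzw⟩ := h.exists_mul z hz
    refine ⟨_, ⟨s, w, hw, rfl⟩, ?_⟩
    rw [map_add, hzw, mul_add, ← mul_assoc, ← pow_add, Nat.add_sub_cancel' hi, map_mul, map_pow,
      mul_comm]
  · rintro ⟨_, ⟨s, w, hw, rfl⟩, rfl⟩
    obtain ⟨x, hx, hxw⟩ := h.exists_mem w hw
    refine ⟨s * α ^ i + x, Submodule.mem_sup.2 ⟨_, Ideal.mul_mem_left _ _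
      (Ideal.mem_span_singleton_self _), x, hx, rfl⟩, ?_⟩
    rw [map_add, hxw, mul_add, ← mul_assoc, ← pow_add, Nat.add_sub_cancel' hi, map_mul, map_pow,
      mul_comm]

theorem finite (h : IsFreeOverring α ℓ I B b) : Module.Finite R B := by
  classical
  have : B.toSubmodule.FG := by
    refine ⟨insert 1 (Finset.univ.image b), le_antisymm (Submodule.span_le.2 ?_) ?_⟩
    · intro y hy
      simp only [Finset.coe_insert, Finset.coe_image, Finset.coe_univ, Set.image_univ] at hy
      rcases hy with rfl | ⟨j, rfl⟩
      · exact B.one_mem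
      · exact h.basis_mem j
    · intro y hy
      obtain ⟨r, s, rfl⟩ := (h.mem_iff y).1 hy
      refine add_mem ?_ (Submodule.sum_mem _ fun j _ => ?_)
      · rw [Algebra.algebraMap_eq_smul_one]
        exact Submodule.smul_mem _ _ (Submodule.subset_span (by simp))
      · rw [← Algebra.smul_def]
        exact Submodule.smul_mem _ _ (Submodule.subset_span (by simp))
  exact Module.Finite.of_fg this

theorem finite_addPowMul [IsNoetherianRing R] (h : IsFreeOverring α ℓ I B b) (q : ℕ) :
    Module.Finite R (addPowMul B α q) := by
  have := h.finite
  have : IsNoetherian R B := isNoetherian_of_isNoetherianRing_of_finite R B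
  exact Module.Finite.of_injective (Subalgebra.inclusion (addPowMul_le B α q)).toLinearMap
    (Subalgebra.inclusion_injective (addPowMul_le B α q))

theorem addPowMul_lt (h : IsFreeOverring α ℓ I B b) (hn : 0 < n) {q : ℕ}
    (hq : q < ℓ) : addPowMul B α (q + 1) < addPowMul B α q := by
  refine lt_of_le_not_ge (addPowMul_anti B α (Nat.le_succ q)) fun hle => ?_
  obtain ⟨r, z, hz, hrz⟩ := hle (pow_mul_mem_addPowMul le_rfl (h.basis_mem ⟨0, hn⟩))
  obtain ⟨r', s, rfl⟩ := (h.mem_iff z).1 hz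
  have h1 := (h.indep (r + α ^ (q + 1) * r')
    (fun j => α ^ (q + 1) * s j - (Pi.single ⟨0, hn⟩ (α ^ q) : Fin n → R) j) 0 I.zero_mem (by
      simp only [map_sub, sub_mul, Finset.sum_sub_distrib]
      rw [Finset.sum_eq_single (f := fun j => algebraMap R K
        ((Pi.single ⟨0, hn⟩ (α ^ q) : Fin n → R) j) * b j) ⟨0, hn⟩
        (fun j _ hj => by simp [hj]) (by simp), Pi.single_eq_same, map_pow, hrz]
      simp only [map_mul, map_add, map_pow, mul_add, Finset.mul_sum, map_zero, mul_assoc]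
      ring)).2 ⟨0, hn⟩
  rw [Pi.single_eq_same] at h1
  refine h.pow_notMem_sup hq (Submodule.mem_sup.2 ⟨α ^ (q + 1) * s ⟨0, hn⟩,
    Ideal.mul_mem_right _ _ (Ideal.mem_span_singleton_self _), _, neg_mem h1, by ring⟩)

variable [IsFractionRing R K]

theorem overring_eq (h : IsFreeOverring α ℓ I B b) (hα0 : α ∈ R⁰) {c : ℕ → Ideal R}
    (hc : ∀ i, 1 ≤ i → i ≤ ℓ → c i = Ideal.span {α ^ i} ⊔ I) {i : ℕ} (hi : i ≤ ℓ) :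
    overring K c i = addPowMul B α (ℓ - i) := by
  rcases i with _ | i
  · rw [Nat.sub_zero, h.addPowMul_last]
    rfl
  · rw [overring, hc _ (by omega) hi]
    exact selfColon_eq_of_mem_iff
      ((IsLocalization.map_units K (⟨α, hα0⟩ : R⁰)).pow _) (h.mem_coeSubmodule_sup hi)

end IsFreeOverring

end Tower

section Stages

variable {R : Type*} [CommRing R] {K : Type*} [CommRing K] [Algebra R K]

theorem span_pow_sup_eq {α : R} {I : Ideal R} {X : Set R} {i ℓ : ℕ} (hi : i ≤ ℓ)
    (hI : I = Ideal.span (insert (α ^ ℓ) X)) :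
    Ideal.span {α ^ i} ⊔ I = Ideal.span (insert (α ^ i) X) := by
  have hle : Ideal.span {α ^ ℓ} ≤ Ideal.span {α ^ i} :=
    Ideal.span_singleton_le_span_singleton.2 (pow_dvd_pow _ hi)
  rw [hI, Ideal.span_insert, Ideal.span_insert, ← sup_assoc, sup_eq_left.2 hle]

theorem range_option_elim {ι X : Type*} (a : X) (x : ι → X) :
    Set.range (fun o : Option ι => o.elim a x) = insert a (Set.range x) := by
  ext y
  simp [Option.exists, eq_comm]

theorem algebraMap_mem_nonZeroDivisors [IsFractionRing R K] {α : R} (hα0 : α ∈ R⁰) (T : Subalgebra R K) :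
    algebraMap R T α ∈ T⁰ := by
  rw [mem_nonZeroDivisors_iff_left]
  intro y hy
  apply Subtype.ext
  refine algebraMap_mul_cancel hα0 ?_
  rw [ZeroMemClass.coe_zero, mul_zero]
  exact congrArg Subtype.val hy

variable [IsLocalRing R]

theorem isParameterIdeal_span_pow (hdim : ringKrullDim R = 1) {α : R} (hα : α ∈ maximalIdeal R)
    (hα2 : maximalIdeal R ^ 2 = Ideal.span {α} * maximalIdeal R) {i : ℕ} (hi : 1 ≤ i) :
    IsParameterIdeal (Ideal.span {α ^ i}) := by
  refine ⟨le_antisymm ?_ fun x hx => ?_, 1, fun _ => α ^ i, by simpa using hdim, by simp⟩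
  · rw [(maximalIdeal.isMaximal R).isPrime.radical_le_iff, Ideal.span_singleton_le_iff_mem]
    exact Ideal.pow_mem_of_mem _ hα _ hi
  · have hx2 : x ^ 2 ∈ Ideal.span {α} * maximalIdeal R := hα2 ▸ Ideal.pow_mem_pow hx 2
    refine ⟨2 * i, ?_⟩
    rw [pow_mul, Ideal.mem_span_singleton]
    exact pow_dvd_pow_of_dvd (Ideal.mem_span_singleton.1 (Ideal.mul_le_left hx2)) i

variable {α : R} {ℓ : ℕ} {I : Ideal R} {B : Subalgebra R K} {n : ℕ} {b : Fin n → K}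

namespace IsFreeOverring

theorem sup_le_maximalIdeal (h : IsFreeOverring α ℓ I B b) {i : ℕ} (hi : 1 ≤ i) :
    Ideal.span {α ^ i} ⊔ I ≤ maximalIdeal R :=
  sup_le ((Ideal.span_singleton_le_iff_mem _).2 (Ideal.pow_mem_of_mem _ h.mem_maximalIdeal _ hi))
    h.ideal_le

/-! ### The local rings of the tower -/

/-- The set `α (R + α ^ q B)` contains every non-unit of `R + α ^ (q + 1) B`. -/
theorem isUnit_or_exists_mul [IsNoetherianRing R] (h : IsFreeOverring α ℓ I B b) {q : ℕ} (hq : q < ℓ)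
    (y : addPowMul B α (q + 1)) :
    IsUnit y ∨ ∃ z ∈ addPowMul B α q, (y : K) = algebraMap R K α * z := by
  obtain ⟨r, z, hz, hy⟩ := y.2
  by_cases hr : r ∈ maximalIdeal R
  · right
    rw [h.maximalIdeal_eq] at hr
    obtain ⟨v, hv, w, hw, rfl⟩ := Submodule.mem_sup.1 hr
    obtain ⟨s, rfl⟩ := Ideal.mem_span_singleton'.1 hv
    obtain ⟨w', hw', hww'⟩ := h.exists_mul w hw
    refine ⟨algebraMap R K s + algebraMap R K α ^ (ℓ - 1) * w' + algebraMap R K α ^ q * z,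
      add_mem (add_mem (Subalgebra.algebraMap_mem _ _) (pow_mul_mem_addPowMul (by omega) hw'))
        (pow_mul_mem_addPowMul le_rfl hz), ?_⟩
    have hpow : algebraMap R K α ^ ℓ = algebraMap R K α * algebraMap R K α ^ (ℓ - 1) := by
      rw [← pow_succ', Nat.sub_add_cancel h.one_le]
    rw [hy, map_add, hww', hpow, map_mul]
    ring
  · left
    obtain ⟨u, rfl⟩ : IsUnit r := by simpa using hr
    have := h.finite_addPowMul (q + 1)
    have hjac := algebraMap_mem_jacobson_bot h.mem_maximalIdeal (addPowMul B α (q + 1))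
    rw [Ideal.mem_jacobson_bot] at hjac
    have hvz : algebraMap R K ((u⁻¹ : Rˣ) : R) * z ∈ B := mul_mem (B.algebraMap_mem _) hz
    have hunit := (((u.isUnit).map (algebraMap R (addPowMul B α (q + 1)))).pow 2).mul
      (hjac ⟨algebraMap R K α ^ (2 * q + 1) * (-((algebraMap R K ((u⁻¹ : Rˣ) : R) * z) *
        (algebraMap R K ((u⁻¹ : Rˣ) : R) * z))),
        pow_mul_mem_addPowMul (by omega) (neg_mem (mul_mem hvz hvz))⟩)
    let y' : addPowMul B α (q + 1) := ⟨algebraMap R K (u : R) - algebraMap R K α ^ (q + 1) * z,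
      sub_mem (Subalgebra.algebraMap_mem _ _) (pow_mul_mem_addPowMul le_rfl hz)⟩
    refine isUnit_of_mul_isUnit_left (y := y') ?_
    convert hunit using 1
    apply Subtype.ext
    have huv : algebraMap R K (u : R) * algebraMap R K ((u⁻¹ : Rˣ) : R) = 1 := by
      rw [← map_mul, Units.mul_inv, map_one]
    have e : algebraMap R K (u : R) ^ 2 * (algebraMap R K α * (algebraMap R K α ^ (2 * q + 1) *
        (-((algebraMap R K ((u⁻¹ : Rˣ) : R) * z) * (algebraMap R K ((u⁻¹ : Rˣ) : R) * z)))) + 1) =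
        algebraMap R K (u : R) ^ 2 - algebraMap R K α ^ (2 * q + 2) * z ^ 2 *
          (algebraMap R K (u : R) * algebraMap R K ((u⁻¹ : Rˣ) : R)) ^ 2 := by
      ring
    rw [huv] at e
    refine Eq.trans ?_ e.symm
    change (y : K) * (algebraMap R K (u : R) - algebraMap R K α ^ (q + 1) * z) = _
    rw [hy]
    ring

variable [IsFractionRing R K]

theorem not_isUnit_of_eq_mul [IsNoetherianRing R] (h : IsFreeOverring α ℓ I B b) {q : ℕ}
    {y : addPowMul B α (q + 1)} {z : K} (hz : z ∈ addPowMul B α q)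
    (hyz : (y : K) = algebraMap R K α * z) : ¬ IsUnit y := by
  rintro ⟨u, rfl⟩
  have := h.finite
  have hjac := algebraMap_mem_jacobson_bot h.mem_maximalIdeal B
  rw [Ideal.mem_jacobson_bot] at hjac
  have hu := hjac (-(⟨z, addPowMul_le _ _ _ hz⟩ *
    ⟨((u⁻¹ : (addPowMul B α (q + 1))ˣ) : addPowMul B α (q + 1)), addPowMul_le _ _ _ (Subtype.prop _)⟩))
  have huv : ((u : addPowMul B α (q + 1)) : K) *
      (((u⁻¹ : (addPowMul B α (q + 1))ˣ) : addPowMul B α (q + 1)) : K) = 1 :=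
    congrArg Subtype.val u.mul_inv
  have hK : Nontrivial K := (IsFractionRing.injective R K).nontrivial
  have hu' : IsUnit (algebraMap R K α * -(z *
      (((u⁻¹ : (addPowMul B α (q + 1))ˣ) : addPowMul B α (q + 1)) : K)) + 1) := hu.map B.val
  rw [hyz] at huv
  rw [mul_neg, ← mul_assoc, huv, neg_add_cancel] at hu'
  exact not_isUnit_zero hu'

theorem not_isUnit_iff [IsNoetherianRing R] (h : IsFreeOverring α ℓ I B b) {q : ℕ} (hq : q < ℓ)
    (y : addPowMul B α (q + 1)) :
    ¬ IsUnit y ↔ ∃ z ∈ addPowMul B α q, (y : K) = algebraMap R K α * z :=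
  ⟨(h.isUnit_or_exists_mul hq y).resolve_left, fun ⟨_, hz, hy⟩ => h.not_isUnit_of_eq_mul hz hy⟩

theorem isLocalRing_addPowMul [IsNoetherianRing R] (h : IsFreeOverring α ℓ I B b) {q : ℕ}
    (hq : q < ℓ) : IsLocalRing (addPowMul B α (q + 1)) := by
  have hK : Nontrivial K := (IsFractionRing.injective R K).nontrivial
  refine IsLocalRing.of_nonunits_add fun y y' hy hy' => ?_
  rw [mem_nonunits_iff, h.not_isUnit_iff hq] at hy hy' ⊢
  obtain ⟨z, hz, hyz⟩ := hy
  obtain ⟨z', hz', hyz'⟩ := hy'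
  refine ⟨z + z', add_mem hz hz', ?_⟩
  rw [mul_add, ← hyz, ← hyz']
  rfl

theorem mem_maximalIdeal_addPowMul [IsNoetherianRing R] (h : IsFreeOverring α ℓ I B b) {q : ℕ}
    (hq : q < ℓ) [IsLocalRing (addPowMul B α (q + 1))] (y : addPowMul B α (q + 1)) :
    y ∈ maximalIdeal (addPowMul B α (q + 1)) ↔
      ∃ z ∈ addPowMul B α q, (y : K) = algebraMap R K α * z := by
  rw [IsLocalRing.mem_maximalIdeal, mem_nonunits_iff, h.not_isUnit_iff hq]

theorem algebraMap_mem_maximalIdeal [IsNoetherianRing R] (h : IsFreeOverring α ℓ I B b) {q : ℕ}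
    (hq : q < ℓ) [IsLocalRing (addPowMul B α (q + 1))] :
    algebraMap R (addPowMul B α (q + 1)) α ∈ maximalIdeal (addPowMul B α (q + 1)) :=
  (h.mem_maximalIdeal_addPowMul hq _).2 ⟨1, one_mem _, (mul_one _).symm⟩

theorem maximalIdeal_addPowMul_sq [IsNoetherianRing R] (h : IsFreeOverring α ℓ I B b) {q : ℕ}
    (hq : q < ℓ) [IsLocalRing (addPowMul B α (q + 1))] :
    maximalIdeal (addPowMul B α (q + 1)) ^ 2 =
      Ideal.span {algebraMap R (addPowMul B α (q + 1)) α} *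
        maximalIdeal (addPowMul B α (q + 1)) := by
  rw [sq]
  refine le_antisymm (Ideal.mul_le.2 fun y hy y' hy' => ?_) (Ideal.mul_mono_left
    ((Ideal.span_singleton_le_iff_mem _).2 (h.algebraMap_mem_maximalIdeal hq)))
  rw [h.mem_maximalIdeal_addPowMul hq] at hy hy'
  obtain ⟨z, hz, hyz⟩ := hy
  obtain ⟨z', hz', hyz'⟩ := hy'
  have hmem : algebraMap R K α * (z * z') ∈ addPowMul B α (q + 1) := by
    obtain ⟨s, w, hw, hsw⟩ := mul_mem hz hz'
    refine ⟨α * s, w, hw, ?_⟩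
    rw [hsw, map_mul]
    ring
  refine Ideal.mem_span_singleton_mul.2 ⟨⟨_, hmem⟩, (h.mem_maximalIdeal_addPowMul hq _).2
    ⟨z * z', mul_mem hz hz', rfl⟩, Subtype.ext ?_⟩
  change algebraMap R K α * (algebraMap R K α * (z * z')) = (y : K) * (y' : K)
  rw [hyz, hyz']
  ring

theorem mem_maximalIdeal_addPowMul_sq [IsNoetherianRing R] (h : IsFreeOverring α ℓ I B b) {q : ℕ}
    (hq : q < ℓ) [IsLocalRing (addPowMul B α (q + 1))] {y : addPowMul B α (q + 1)}
    (hy : y ∈ maximalIdeal (addPowMul B α (q + 1)) ^ 2) :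
    ∃ z ∈ addPowMul B α q, (y : K) = algebraMap R K α * (algebraMap R K α * z) := by
  rw [h.maximalIdeal_addPowMul_sq hq, Ideal.mem_span_singleton_mul] at hy
  obtain ⟨w, hw, rfl⟩ := hy
  obtain ⟨z, hz, hwz⟩ := (h.mem_maximalIdeal_addPowMul hq w).1 hw
  refine ⟨z, hz, ?_⟩
  rw [← hwz]
  rfl

theorem mem_maximalIdeal_of_combination (h : IsFreeOverring α ℓ I B b) (hα0 : α ∈ R⁰) {q : ℕ}
    (hq : q < ℓ) {r : R} {s : Fin n → R} {z : K} (hz : z ∈ addPowMul B α q)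
    (hrs : algebraMap R K r * algebraMap R K α +
      ∑ j, algebraMap R K (s j) * (algebraMap R K α ^ (q + 1) * b j) =
        algebraMap R K α * (algebraMap R K α * z)) :
    r ∈ maximalIdeal R ∧ ∀ j, s j ∈ maximalIdeal R := by
  obtain ⟨t, w, hw, rfl⟩ := hz
  obtain ⟨t', v, rfl⟩ := (h.mem_iff w).1 hw
  have hα := h.mem_maximalIdeal
  obtain ⟨h1, h2⟩ := h.indep (r - α * t - α ^ (q + 1) * t')
    (fun j => α ^ q * (s j - α * v j)) 0 I.zero_mem (by
      refine algebraMap_mul_cancel hα0 ?_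
      rw [map_zero, mul_zero, ← sub_eq_zero.2 hrs]
      simp only [map_sub, map_mul, map_pow, mul_sub, sub_mul, mul_add, Finset.mul_sum,
        Finset.sum_sub_distrib]
      have e1 : ∀ j, algebraMap R K α * (algebraMap R K α ^ q * algebraMap R K (s j) * b j) =
        algebraMap R K (s j) * (algebraMap R K α ^ (q + 1) * b j) := fun j => by ring
      have e2 : ∀ j, algebraMap R K α * (algebraMap R K α ^ q *
          (algebraMap R K α * algebraMap R K (v j)) * b j) =
        algebraMap R K α * (algebraMap R K α * (algebraMap R K α ^ q *
          (algebraMap R K (v j) * b j))) := fun j => by ring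
      simp only [e1, e2]
      ring)
  constructor
  · have h3 := add_mem (add_mem (h.ideal_le h1) (Ideal.mul_mem_right t' _
      (Ideal.pow_mem_of_mem _ hα (q + 1) (by omega)))) (Ideal.mul_mem_right t _ hα)
    convert h3 using 1
    ring
  · intro j
    have h3 := mem_sup_of_pow_mul_mem h.maximalIdeal_eq h.pow_notMem (p := q) (q := 1) hq (h2 j)
    rw [pow_one, ← h.maximalIdeal_eq] at h3
    exact (Submodule.sub_mem_iff_left _ (Ideal.mul_mem_right _ _ hα)).1 h3

theorem embDim_addPowMul [IsNoetherianRing R] (h : IsFreeOverring α ℓ I B b) (hα0 : α ∈ R⁰) {q : ℕ}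
    (hq : q < ℓ) [IsLocalRing (addPowMul B α (q + 1))] [IsNoetherianRing (addPowMul B α (q + 1))] :
    embDim (addPowMul B α (q + 1)) = n + 1 := by
  have hw : ∀ j, algebraMap R K α ^ (q + 1) * b j ∈ addPowMul B α (q + 1) := fun j =>
    pow_mul_mem_addPowMul le_rfl (h.basis_mem j)
  let w : Option (Fin n) → addPowMul B α (q + 1) := fun o =>
    o.elim (algebraMap R _ α) fun j => ⟨_, hw j⟩
  have hwm : ∀ o, w o ∈ maximalIdeal (addPowMul B α (q + 1)) := by
    rintro (_ | j)
    · exact h.algebraMap_mem_maximalIdeal hq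
    · refine (h.mem_maximalIdeal_addPowMul hq _).2
        ⟨_, pow_mul_mem_addPowMul le_rfl (h.basis_mem j), ?_⟩
      change algebraMap R K α ^ (q + 1) * b j = _
      ring
  rw [embDim_eq_card w, Fintype.card_option, Fintype.card_fin]
  · refine le_antisymm (fun y hy => ?_) (Ideal.span_le.2 ?_)
    · obtain ⟨_, ⟨t, v, hv, rfl⟩, hyz⟩ := (h.mem_maximalIdeal_addPowMul hq y).1 hy
      obtain ⟨t', s, rfl⟩ := (h.mem_iff v).1 hv
      have hy' : y = algebraMap R _ (t + α ^ q * t') * w none +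
          ∑ j, algebraMap R _ (s j) * w (some j) := by
        apply Subtype.ext
        rw [AddMemClass.coe_add, AddSubmonoidClass.coe_finsetSum]
        change (y : K) = algebraMap R K (t + α ^ q * t') * algebraMap R K α +
          ∑ j, algebraMap R K (s j) * (algebraMap R K α ^ (q + 1) * b j)
        rw [hyz]
        simp only [map_add, map_mul, map_pow, mul_add, Finset.mul_sum]
        have e : ∀ j, algebraMap R K α * (algebraMap R K α ^ q * (algebraMap R K (s j) * b j)) =
          algebraMap R K (s j) * (algebraMap R K α ^ (q + 1) * b j) := fun j => by ring
        simp only [e]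
        ring
      rw [hy']
      exact add_mem (Ideal.mul_mem_left _ _ (Ideal.subset_span ⟨_, rfl⟩))
        (Ideal.sum_mem _ fun j _ => Ideal.mul_mem_left _ _ (Ideal.subset_span ⟨_, rfl⟩))
    · rintro _ ⟨o, rfl⟩
      exact hwm o
  · intro c hc
    have hdec : ∀ y : addPowMul B α (q + 1), ∃ r : R,
        y - algebraMap R _ r ∈ maximalIdeal (addPowMul B α (q + 1)) := by
      intro y
      obtain ⟨r, z, hz, hy⟩ := y.2
      refine ⟨r, (h.mem_maximalIdeal_addPowMul hq _).2
        ⟨_, pow_mul_mem_addPowMul le_rfl hz, ?_⟩⟩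
      change (y : K) - algebraMap R K r = _
      rw [hy]
      ring
    choose r hr using fun o => hdec (c o)
    have hsum : ∑ o, algebraMap R _ (r o) * w o ∈ maximalIdeal (addPowMul B α (q + 1)) ^ 2 := by
      have h1 : ∑ o, (c o - algebraMap R _ (r o)) * w o ∈
          maximalIdeal (addPowMul B α (q + 1)) ^ 2 := by
        rw [sq]
        exact Ideal.sum_mem _ fun o _ => Ideal.mul_mem_mul (hr o) (hwm o)
      convert sub_mem hc h1 using 1
      simp only [sub_mul, Finset.sum_sub_distrib]
      ring
    obtain ⟨z, hz, hzs⟩ := h.mem_maximalIdeal_addPowMul_sq hq hsum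
    have hmem := h.mem_maximalIdeal_of_combination hα0 hq (r := r none) (s := fun j => r (some j)) hz
      (by
        rw [← hzs, Fintype.sum_option, AddMemClass.coe_add, AddSubmonoidClass.coe_finsetSum]
        rfl)
    have hall : ∀ o, r o ∈ maximalIdeal R := by
      rintro (_ | j)
      exacts [hmem.1, hmem.2 j]
    intro o
    rw [← sub_add_cancel (c o) (algebraMap R _ (r o))]
    refine add_mem (hr o) ?_
    have := h.finite_addPowMul (q + 1)
    rw [← jacobson_eq_maximalIdeal ⊥ bot_ne_top]
    exact algebraMap_mem_jacobson_bot (hall o) _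

theorem mem_jacobsonSubmodule (h : IsFreeOverring α ℓ I B b) [IsNoetherianRing R] {q : ℕ}
    (hq : q < ℓ) (y : K) : y ∈ jacobsonSubmodule (addPowMul B α (q + 1)) ↔
      ∃ z ∈ addPowMul B α q, y = algebraMap R K α * z := by
  have := h.isLocalRing_addPowMul hq
  rw [jacobsonSubmodule, jacobsonRadical, jacobson_eq_maximalIdeal ⊥ bot_ne_top]
  constructor
  · rintro ⟨y, hy, rfl⟩
    exact (h.mem_maximalIdeal_addPowMul hq y).1 hy
  · rintro ⟨z, hz, rfl⟩
    have hmem : algebraMap R K α * z ∈ addPowMul B α (q + 1) := by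
      obtain ⟨r, w, hw, rfl⟩ := hz
      refine ⟨α * r, w, hw, ?_⟩
      rw [map_mul]
      ring
    exact ⟨⟨_, hmem⟩, (h.mem_maximalIdeal_addPowMul hq _).2 ⟨z, hz, rfl⟩, rfl⟩

/-! ### The ideals of the series are Ulrich -/

theorem sup_sq (h : IsFreeOverring α ℓ I B b) {i : ℕ} (hi : i ≤ ℓ) :
    (Ideal.span {α ^ i} ⊔ I) ^ 2 = Ideal.span {α ^ i} * (Ideal.span {α ^ i} ⊔ I) := by
  rw [sq]
  refine le_antisymm (Ideal.mul_le.2 fun x hx y hy => ?_) (Ideal.mul_mono_left le_sup_left)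
  obtain ⟨z, hz, hxz⟩ := (h.mem_coeSubmodule_sup hi _).1
    ((IsLocalization.mem_coeSubmodule K _).2 ⟨x, hx, rfl⟩)
  obtain ⟨z', hz', hyz⟩ := (h.mem_coeSubmodule_sup hi _).1
    ((IsLocalization.mem_coeSubmodule K _).2 ⟨y, hy, rfl⟩)
  obtain ⟨w, hw, hwz⟩ := (IsLocalization.mem_coeSubmodule K _).1
    ((h.mem_coeSubmodule_sup hi _).2 ⟨z * z', mul_mem hz hz', rfl⟩)
  refine Ideal.mem_span_singleton_mul.2 ⟨w, hw, IsFractionRing.injective R K ?_⟩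
  rw [map_mul, map_mul, hwz, hxz, hyz, map_pow]
  ring

theorem isReduction_sup (h : IsFreeOverring α ℓ I B b) {i : ℕ} (hi : i ≤ ℓ) :
    IsReduction (Ideal.span {α ^ i}) (Ideal.span {α ^ i} ⊔ I) :=
  ⟨le_sup_left, 1, by rw [pow_one, one_add_one_eq_two, h.sup_sq hi]⟩

theorem exists_generators (h : IsFreeOverring α ℓ I B b) (hα0 : α ∈ R⁰) : ∃ x : Fin n → R,
    (∀ j, x j ∈ I) ∧ I = Ideal.span (insert (α ^ ℓ) (Set.range x)) ∧
    (∀ j, algebraMap R K (x j) = algebraMap R K α ^ ℓ * b j) ∧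
    ∀ i ≤ ℓ, ∀ r : Option (Fin n) → R,
      ∑ o, r o * o.elim (α ^ i) x ∈ (Ideal.span {α ^ i} ⊔ I) ^ 2 →
        ∀ o, r o ∈ Ideal.span {α ^ i} ⊔ I := by
  have hinj := IsFractionRing.injective R K
  choose x hxI hx using fun j => h.exists_mem (b j) (h.basis_mem j)
  refine ⟨x, hxI, ?_, hx, ?_⟩
  · refine le_antisymm (fun y hy => ?_) (Ideal.span_le.2 ?_)
    · obtain ⟨v, hv, hyv⟩ := h.exists_mul y hy
      obtain ⟨t, s, rfl⟩ := (h.mem_iff v).1 hv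
      have hy' : y = t * α ^ ℓ + ∑ j, s j * x j := by
        apply hinj
        rw [hyv]
        simp only [map_add, map_sum, map_mul, map_pow, hx, mul_add, Finset.mul_sum]
        have e : ∀ j, algebraMap R K α ^ ℓ * (algebraMap R K (s j) * b j) =
          algebraMap R K (s j) * (algebraMap R K α ^ ℓ * b j) := fun j => by ring
        simp only [e]
        ring
      rw [hy']
      exact add_mem (Ideal.mul_mem_left _ _ (Ideal.subset_span (Set.mem_insert _ _)))
        (Ideal.sum_mem _ fun j _ => Ideal.mul_mem_left _ _
          (Ideal.subset_span (Set.mem_insert_of_mem _ ⟨j, rfl⟩)))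
    · rintro _ (rfl | ⟨j, rfl⟩)
      exacts [h.pow_mem, hxI j]
  · intro i hi r hr
    rw [h.sup_sq hi, Ideal.mem_span_singleton_mul] at hr
    obtain ⟨w, hw, hwr⟩ := hr
    obtain ⟨y, hy, z, hz, rfl⟩ := Submodule.mem_sup.1 hw
    obtain ⟨t, rfl⟩ := Ideal.mem_span_singleton'.1 hy
    obtain ⟨h1, h2⟩ := h.indep (r none - t * α ^ i) (fun j => α ^ (ℓ - i) * r (some j)) z hz (by
      refine algebraMap_mul_cancel (_root_.pow_mem hα0 i) ?_
      have h3 := congrArg (algebraMap R K) hwr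
      rw [Fintype.sum_option] at h3
      simp only [Option.elim, map_mul, map_add, map_sum, map_pow, hx] at h3
      have e : ∀ j, algebraMap R K α ^ i * (algebraMap R K α ^ (ℓ - i) * algebraMap R K (r (some j))
          * b j) = algebraMap R K (r (some j)) * (algebraMap R K α ^ ℓ * b j) := fun j => by
        rw [← mul_assoc, ← mul_assoc, ← pow_add, Nat.add_sub_cancel' hi]
        ring
      simp only [map_sub, map_mul, map_pow, mul_add, Finset.mul_sum, e]
      rw [← sub_eq_zero] at h3 ⊢
      rw [← neg_eq_zero, ← h3]
      ring)
    rintro (_ | j)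
    · exact Submodule.mem_sup.2 ⟨t * α ^ i, hy, _, h1, by ring⟩
    · exact mem_sup_of_pow_mul_mem h.maximalIdeal_eq h.pow_notMem (by omega) (h2 j)

theorem isUlrich_sup (h : IsFreeOverring α ℓ I B b) (hn : 0 < n) (hα0 : α ∈ R⁰)
    (hdim : ringKrullDim R = 1)
    (hα2 : maximalIdeal R ^ 2 = Ideal.span {α} * maximalIdeal R) {i : ℕ} (h1 : 1 ≤ i) (hi : i ≤ ℓ) :
    IsUlrich (Ideal.span {α ^ i} ⊔ I) := by
  have hpar := isParameterIdeal_span_pow hdim h.mem_maximalIdeal hα2 h1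
  obtain ⟨x, hxI, hspan, hx, hind⟩ := h.exists_generators hα0
  refine ⟨le_antisymm ?_ (hpar.1 ▸ Ideal.radical_mono le_sup_left), ⟨_, hpar, h.isReduction_sup hi,
    fun heq => ?_, h.sup_sq hi⟩, ?_⟩
  · rw [(maximalIdeal.isMaximal R).isPrime.radical_le_iff]
    exact h.sup_le_maximalIdeal h1
  · have hx0 : x ⟨0, hn⟩ ∈ Ideal.span {α ^ i} := heq ▸ Ideal.mem_sup_right (hxI _)
    obtain ⟨s, hs⟩ := Ideal.mem_span_singleton'.1 hx0
    refine h.pow_notMem (ℓ - i) (by omega) ?_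
    have h2 := (h.indep (-s) (Pi.single ⟨0, hn⟩ (α ^ (ℓ - i))) 0 I.zero_mem (by
      rw [Finset.sum_eq_single ⟨0, hn⟩ (fun j _ hj => by simp [hj]) (by simp), Pi.single_eq_same]
      refine algebraMap_mul_cancel (_root_.pow_mem hα0 i) ?_
      rw [mul_add, ← mul_assoc, ← map_mul, ← map_mul, ← pow_add, Nat.add_sub_cancel' hi, map_pow _ α ℓ, ← hx,
        ← hs]
      simp only [map_mul, map_neg, map_zero]
      ring)).2 ⟨0, hn⟩
    simpa using h2
  · have hgen := span_pow_sup_eq hi hspan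
    rw [← range_option_elim] at hgen
    obtain ⟨f⟩ := exists_cotangent_basis _ hgen (hind i hi)
    exact Module.Free.of_basis f

theorem embDim_eq [IsNoetherianRing R] (h : IsFreeOverring α ℓ I B b) (hα0 : α ∈ R⁰) :
    embDim R = n + 1 := by
  obtain ⟨x, hxI, hspan, hx, hind⟩ := h.exists_generators hα0
  have hgen := span_pow_sup_eq h.one_le hspan
  have hind := hind 1 h.one_le
  rw [← range_option_elim] at hgen
  simp only [pow_one, ← h.maximalIdeal_eq] at hgen hind
  rw [embDim_eq_card _ hgen hind, Fintype.card_option, Fintype.card_fin]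

end IsFreeOverring

end Stages

end UlrichChain

open UlrichChain in
theorem theorem5p4 {R : Type*} [CommRing R] [IsLocalRing R]
    (hCM : IsCohenMacaulayLocal R) (hdim : ringKrullDim R = 1)
    (K : Type*) [CommRing K] [Algebra R K] [IsFractionRing R K]
    (e : ℕ) (he : HasMultiplicity R e) (hv : embDim R = e) (he1 : 1 < e)
    (α : R) (hα : α ∈ maximalIdeal R)
    (hα2 : maximalIdeal R ^ 2 = Ideal.span {α} * maximalIdeal R)
    (I : Ideal R) (hI : IsUlrich I) :
    -- a composition series consisting of Ulrich ideals exists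
    (∃ (ℓ : ℕ) (c : ℕ → Ideal R), IsCompSeries I ℓ c ∧ ∀ i, 1 ≤ i → i ≤ ℓ → IsUlrich (c i)) ∧
    ∀ (ℓ : ℕ) (c : ℕ → Ideal R), IsCompSeries I ℓ c →
      (∀ i, 1 ≤ i → i ≤ ℓ → IsUlrich (c i)) →
      Module.length R (R ⧸ I) = (ℓ : ℕ∞) ∧
      -- the tower of birational finite extensions
      (∀ i, i < ℓ → overring K c i < overring K c (i + 1)) ∧
      overring K c ℓ ≤ integralClosure R K ∧
      (∀ i, i ≤ ℓ → Module.Finite R (overring K c i)) ∧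
      -- (1)
      (∀ i, 1 ≤ i → i ≤ ℓ → IsReduction (Ideal.span {α ^ i}) (c i)) ∧
      -- (2)
      (∀ i, 1 ≤ i → i ≤ ℓ →
        overring K c i = selfColon (jacobsonSubmodule (overring K c (i - 1)))) ∧
      -- (3)
      (∀ i, i < ℓ → ∃ _ : IsLocalRing (overring K c i),
        jacobsonRadical (overring K c i) = maximalIdeal (overring K c i) ∧
        IsCohenMacaulayLocal (overring K c i) ∧
        ringKrullDim (overring K c i) = 1 ∧
        embDim (overring K c i) = e ∧
        HasMultiplicity (overring K c i) e ∧
        jacobsonRadical (overring K c i) ^ 2 =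
          Ideal.span {algebraMap R (overring K c i) α} * jacobsonRadical (overring K c i)) ∧
      -- (4)
      (∃ x : Fin (embDim R - 1) → R, (∀ j, x j ∈ I) ∧
        I = Ideal.span (insert (α ^ ℓ) (Set.range x))) ∧
      (∀ x : Fin (embDim R - 1) → R, (∀ j, x j ∈ I) →
        I = Ideal.span (insert (α ^ ℓ) (Set.range x)) →
        (∀ i, 1 ≤ i → i ≤ ℓ → c i = Ideal.span (insert (α ^ i) (Set.range x))) ∧
        maximalIdeal R = Ideal.span (insert α (Set.range x))) ∧
      (∀ (n : ℕ) (d : ℕ → Ideal R), IsCompSeries I n d →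
        n = ℓ ∧ ∀ i, 1 ≤ i → i ≤ ℓ → d i = c i) ∧
      -- (5)
      (∀ J : Ideal R, I ≤ J → J ≤ maximalIdeal R → ∃ i, 1 ≤ i ∧ i ≤ ℓ ∧ J = c i) := by
  have hNoeth : IsNoetherianRing R := hCM.1
  obtain ⟨t, htm, ht0⟩ := hCM.exists_mem_nonZeroDivisors hdim
  have hα0 : α ∈ R⁰ := by
    have ht2 : t ^ 2 ∈ Ideal.span {α} * maximalIdeal R := hα2 ▸ Ideal.pow_mem_pow htm 2
    exact mem_nonZeroDivisors_of_dvd_pow ht0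
      (Ideal.mem_span_singleton.1 (Ideal.mul_le_left ht2))
  obtain ⟨a, n, x₀, haI, ha0, hsq, hgen, hxI, hind⟩ := hI.exists_generators hdim htm ht0
  have hIm : I ≤ maximalIdeal R := hI.radical_eq ▸ Ideal.le_radical
  have hαI : ∃ k, α ^ k ∈ I := by
    rw [← hI.radical_eq] at hα
    exact hα
  obtain ⟨ℓ, B, b, h⟩ := exists_isFreeOverring K hα hα0 hα2 hIm hαI haI ha0 hsq hgen hxI hind
  refine ⟨⟨ℓ, _, h.isCompSeries, fun i h1 hi => h.isUlrich_sup n.succ_pos hα0 hdim hα2 h1 hi⟩, ?_⟩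
  intro m c hcs _
  obtain ⟨rfl, hc⟩ := h.eq_of_isCompSeries hcs
  have hov : ∀ {i}, i ≤ m → overring K c i = addPowMul B α (m - i) := h.overring_eq hα0 hc
  have hfin := h.finite_addPowMul
  refine ⟨?_, ?_, ?_, ?_, ?_, ?_, ?_, ?_, ?_, ?_, ?_⟩
  · rw [← hcs.last]
    exact hcs.length_quotient hcs.one_le le_rfl
  · intro i hi
    rw [hov hi.le, hov hi, show m - i = m - (i + 1) + 1 by omega]
    exact h.addPowMul_lt n.succ_pos (by omega)
  · rw [hov le_rfl]
    exact le_integralClosure_of_finite _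
  · intro i hi
    rw [hov hi]
    exact hfin _
  · intro i h1 hi
    rw [hc i h1 hi]
    exact h.isReduction_sup hi
  · intro i h1 hi
    rw [hov hi, hov (by omega), show m - (i - 1) = m - i + 1 by omega]
    exact (selfColon_eq_of_mem_iff (IsLocalization.map_units K (⟨α, hα0⟩ : R⁰))
      (h.mem_jacobsonSubmodule (by omega))).symm
  · intro i hi
    rw [hov hi.le, show m - i = m - (i + 1) + 1 by omega]
    have hq : m - (i + 1) < m := by omega
    have hloc := h.isLocalRing_addPowMul hq
    have hN : IsNoetherianRing (addPowMul B α (m - (i + 1) + 1)) := IsNoetherianRing.of_finite R _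
    have hjac : jacobsonRadical (addPowMul B α (m - (i + 1) + 1)) = maximalIdeal _ :=
      jacobson_eq_maximalIdeal ⊥ bot_ne_top
    have hmem := h.algebraMap_mem_maximalIdeal hq
    have hreg := algebraMap_mem_nonZeroDivisors hα0 (addPowMul B α (m - (i + 1) + 1))
    have hsq' := h.maximalIdeal_addPowMul_sq hq
    have hemb : embDim (addPowMul B α (m - (i + 1) + 1)) = e := by
      rw [h.embDim_addPowMul hα0 hq, ← hv, h.embDim_eq hα0]
    refine ⟨hloc, hjac, isCohenMacaulayLocal_of_sq_eq hmem hreg hsq',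
      ringKrullDim_eq_one_of_sq_eq hmem hreg hsq', hemb, hemb ▸ hasMultiplicity_embDim hreg hsq', ?_⟩
    rw [hjac]
    exact hsq'
  · rw [h.embDim_eq hα0]
    obtain ⟨x, hx, hspan, -⟩ := h.exists_generators hα0
    exact ⟨x, hx, hspan⟩
  · intro x _ hspan
    refine ⟨fun i h1 hi => (hc i h1 hi).trans (span_pow_sup_eq hi hspan), ?_⟩
    have := span_pow_sup_eq h.one_le hspan
    rwa [pow_one, ← h.maximalIdeal_eq] at this
  · intro k d hd
    obtain ⟨rfl, hd'⟩ := h.eq_of_isCompSeries hd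
    exact ⟨rfl, fun i h1 hi => (hd' i h1 hi).trans (hc i h1 hi).symm⟩
  · intro J hIJ hJ
    obtain ⟨i, h1, hi, rfl⟩ := h.eq_sup_of_le hIJ hJ
    exact ⟨i, h1, hi, (hc i h1 hi).symm⟩
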